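/- Throughout, manifolds are smooth, finite-dimensional, Hausdorff, second countable and without boundary. Let $Q$ be a Riemannian manifold of dimension $n$ (not necessarily connected), let $K:TQ\to\mathbb{R}$, $K(q,\dot q)=\frac12\|\dot q\|_q^2$, be its kinetic energy, and let $F:Q\to\mathbb{R}$ be a smooth function whose critical points are all contained in some embedded (not necessarily closed) codimension-$1$ submanifold of $Q$. Give $C^\infty(Q,\mathbb{R})$ the strong (Whitney) $C^\infty$ topology, whose basic neighbourhoods of $f$ are the sets of all $h\in C^\infty(Q,\mathbb{R})$ such that, for every $i$, the partial derivatives of $h-f$ of order at most $r$ in the chart $\varphi_i$ are smaller than $\varepsilon_i$ on $K_i$; here $r\in\mathbb{N}$, $(\varphi_i,U_i)_i$ is a locally finite family of smooth charts, $K_i\subseteq U_i$ is compact and $\varepsilon_i>0$. A subset is residual if it contains the intersection of countably many open dense sets. Then there is a residual subset $\mathcal{C}$ of $C^\infty(Q,\mathbb{R})$ such that, for every $V\in\mathcal{C}$, the following hold for the Lagrangian $L(q,\dot q)=K(q,\dot q)-V(q)$. 1. The Euler–Lagrange equations of $L$ have no non-equilibrium solution along which $F$ is constant: if $J\subseteq\mathbb{R}$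 is a nonempty open interval, $\gamma:J\to Q$ is a ($C^2$) solution of the Euler–Lagrange equations, and $F\circ\gamma$ is constant, then there is an equilibrium $q$ with $\gamma(t)=q$ for all $t\in J$. 2. The equilibria of $L$, i.e. the points $q\in Q$ at which the constant curve is a solution of the Euler–Lagrange equations, are isolated: each equilibrium has a neighbourhood in $Q$ that contains no other equilibrium. -/

import Mathlib

open scoped Manifold ContDiff Topology

noncomputable section

/-- The local representative of a Lagrangian `L : TQ → ℝ` in a chart `φ` of `Q`: in the induced
coordinates `(y, v)` on `TQ` it is `L` at the tangent vector `D(φ⁻¹)_y v`, based at `φ⁻¹ y`. -/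
def localLagrangian {n : ℕ} {Q : Type*} [TopologicalSpace Q]
    [ChartedSpace (EuclideanSpace ℝ (Fin n)) Q] [IsManifold (𝓡 n) ∞ Q]
    (L : TangentBundle (𝓡 n) Q → ℝ)
    (φ : OpenPartialHomeomorph Q (EuclideanSpace ℝ (Fin n)))
    (y v : EuclideanSpace ℝ (Fin n)) : ℝ :=
  L ⟨φ.symm y, mfderiv (𝓡 n) (𝓡 n) φ.symm y v⟩

/-- `γ` is a (twice continuously differentiable) solution, on the open set `J` of times, of the
Euler–Lagrange equations `d/dt (∂L/∂v) = ∂L/∂y` of `L`: they hold at each time of `J`, in every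
smooth chart of `Q` around the position of `γ` at that time. -/
structure IsEulerLagrangeSolution {n : ℕ} {Q : Type*} [TopologicalSpace Q]
    [ChartedSpace (EuclideanSpace ℝ (Fin n)) Q] [IsManifold (𝓡 n) ∞ Q]
    (L : TangentBundle (𝓡 n) Q → ℝ) (γ : ℝ → Q) (J : Set ℝ) : Prop where
  contMDiffOn : ContMDiffOn 𝓘(ℝ, ℝ) (𝓡 n) 2 γ J
  eulerLagrange : ∀ t ∈ J, ∀ φ ∈ IsManifold.maximalAtlas (𝓡 n) ∞ Q, γ t ∈ φ.source →
    HasDerivAt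
      (fun s : ℝ ↦ fderiv ℝ (fun v ↦ localLagrangian L φ (φ (γ s)) v)
        (deriv (fun r : ℝ ↦ φ (γ r)) s))
      (fderiv ℝ (fun y ↦ localLagrangian L φ y (deriv (fun r : ℝ ↦ φ (γ r)) t)) (φ (γ t)))
      t

/-- The equilibria of `L`: the points at which the constant curve solves the Euler–Lagrange
equations. -/
def equilibria {n : ℕ} {Q : Type*} [TopologicalSpace Q]
    [ChartedSpace (EuclideanSpace ℝ (Fin n)) Q] [IsManifold (𝓡 n) ∞ Q]
    (L : TangentBundle (𝓡 n) Q → ℝ) : Set Q :=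
  {q | IsEulerLagrangeSolution L (fun _ : ℝ ↦ q) Set.univ}

/-- The kinetic energy `K(q, v) = ½ ‖v‖²_q` of a Riemannian metric. -/
def kineticEnergy {n : ℕ} {Q : Type*} [TopologicalSpace Q]
    [ChartedSpace (EuclideanSpace ℝ (Fin n)) Q] [IsManifold (𝓡 n) ∞ Q]
    (g : Bundle.ContMDiffRiemannianMetric (𝓡 n) ∞ (EuclideanSpace ℝ (Fin n))
      (fun q : Q ↦ TangentSpace (𝓡 n) q))
    (w : TangentBundle (𝓡 n) Q) : ℝ :=
  (1 / 2 : ℝ) * g.inner w.proj w.snd w.snd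

/-- The Lagrangian `L = K - V`. -/
def mechanicalLagrangian {n : ℕ} {Q : Type*} [TopologicalSpace Q]
    [ChartedSpace (EuclideanSpace ℝ (Fin n)) Q] [IsManifold (𝓡 n) ∞ Q]
    (g : Bundle.ContMDiffRiemannianMetric (𝓡 n) ∞ (EuclideanSpace ℝ (Fin n))
      (fun q : Q ↦ TangentSpace (𝓡 n) q))
    (V : Q → ℝ) (w : TangentBundle (𝓡 n) Q) : ℝ :=
  kineticEnergy g w - V w.proj

/-- `Z` is an (embedded, not necessarily closed) submanifold of codimension `k` of the
`n`-manifold `Q`: around each point of `Z` there is a smooth chart of `Q` that maps `Z` to a linear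
subspace of dimension `n - k`. -/
def IsSubmanifoldOfCodim {n : ℕ} {Q : Type*} [TopologicalSpace Q]
    [ChartedSpace (EuclideanSpace ℝ (Fin n)) Q] (k : ℕ) (Z : Set Q) : Prop :=
  ∀ z ∈ Z, ∃ φ ∈ IsManifold.maximalAtlas (𝓡 n) ∞ Q, z ∈ φ.source ∧
    ∃ W : Submodule ℝ (EuclideanSpace ℝ (Fin n)), Module.finrank ℝ W + k = n ∧
      ∀ x ∈ φ.source, x ∈ Z ↔ φ x ∈ W

/-- The basic neighbourhood of `f` in the strong topology given by an order `r`, charts `φ i`,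
sets `K i` inside their domains, and tolerances `ε i`: all `h` whose partial derivatives of order
at most `r` in the chart `φ i` differ on `K i` from those of `f` by less than `ε i`. -/
def strongBasicNhd {n : ℕ} {Q : Type*} [TopologicalSpace Q]
    [ChartedSpace (EuclideanSpace ℝ (Fin n)) Q]
    (f : C^∞⟮𝓡 n, Q; 𝓘(ℝ, ℝ), ℝ⟯) (r : ℕ) {ι : Type}
    (φ : ι → OpenPartialHomeomorph Q (EuclideanSpace ℝ (Fin n))) (K : ι → Set Q) (ε : ι → ℝ) :
    Set C^∞⟮𝓡 n, Q; 𝓘(ℝ, ℝ), ℝ⟯ :=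
  {h | ∀ i, ∀ x ∈ K i, ∀ k ≤ r,
    ‖iteratedFDeriv ℝ k (fun y ↦ h ((φ i).symm y)) (φ i x) -
      iteratedFDeriv ℝ k (fun y ↦ f ((φ i).symm y)) (φ i x)‖ < ε i}

/-- The strong (Whitney) `C^∞` topology on `C^∞(Q, ℝ)`. Its basic open sets are the sets
`strongBasicNhd f r φ K ε` for a finite order `r`, a family of smooth charts `φ i` with locally
finite domains, compact sets `K i` inside those domains, and tolerances `ε i > 0`. (`Q` is meant
to be second countable, so that only countably many of the domains are nonempty.) -/
instance strongTopology (n : ℕ) (Q : Type*) [TopologicalSpace Q]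
    [ChartedSpace (EuclideanSpace ℝ (Fin n)) Q] :
    TopologicalSpace C^∞⟮𝓡 n, Q; 𝓘(ℝ, ℝ), ℝ⟯ :=
  TopologicalSpace.generateFrom
    {N | ∃ (f : C^∞⟮𝓡 n, Q; 𝓘(ℝ, ℝ), ℝ⟯) (r : ℕ) (ι : Type)
      (φ : ι → OpenPartialHomeomorph Q (EuclideanSpace ℝ (Fin n))) (K : ι → Set Q) (ε : ι → ℝ),
      (∀ i, φ i ∈ IsManifold.maximalAtlas (𝓡 n) ∞ Q) ∧
      LocallyFinite (fun i ↦ (φ i).source) ∧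
      (∀ i, IsCompact (K i) ∧ K i ⊆ (φ i).source) ∧
      (∀ i, 0 < ε i) ∧
      N = strongBasicNhd f r φ K ε}

end

/-! In a chart the equations of motion read `c'' = Γ(c, c') - A(c) dV(c)`, with `A` the inverse
metric. If `G` is constant along a solution, all derivatives of `G` along the flow vanish at its
position and velocity. The first of them, `dG(v)`, does not involve `V`. The next `2n + 1` are that
many equations on the `2n`-dimensional space of pairs `(y, v)`, so for generic `V` they should have
no common solution with `v ≠ 0` and `dG ≠ 0`.

To see that they depend independently on `V`, let `w = A dG` be the gradient of `G` at `y₀`. If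
`dG(v) = 0` and `v ≠ 0`, then `v` is not a multiple of `w`, because `dG(w) ≠ 0`; so some linear form
`α` has `α(v) = 1` and `α(w) = 0`. Adding `α(y - y₀)^m dG(y - y₀)` to the potential leaves the
derivatives of order at most `m + 1` at `(y₀, v)` unchanged to first order and changes the one of
order `m + 2` by `-m! dG(w) ≠ 0` (`fderiv_paramDerivAlong_apply`). Letting `m` run from `0` to `2n`
gives a triangular, hence surjective, linear map. Parametric transversality
(`exists_param_forall_ne_zero`) then shows that small polynomial perturbations exclude a compact set
of pairs (`exists_param_derivAlong_ne_zero`). This condition is open and dense in the strong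
topology, and a countable exhaustion by compact sets gives `eventually_residual_deriv_eq_zero`.

Critical points of `F` are handled by a second application. A moving solution in a level set of `F`
must stay in the critical set, hence in the hypersurface, which locally lies in the zero set of a
coordinate form `l` without critical points; the same result with `G = l` forbids this motion
(`IsEulerLagrangeSolution.eventually_eq_of_noLevelMotion`). So the solution is locally constant,
hence constant. Equilibria are critical points of `V`, which are generically nondegenerate by Sard's
theorem for the gradient, hence isolated (`eventually_residual_isolated_critical`). -/

/-! ### Parametric transversality by a Hausdorff dimension count. -/

open Set Module in
/-- If the partial derivative of `F` in its first argument is surjective at a point and `F` has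
more components than the second argument has, then the parameters at which `F` has a zero near
the point form a set of small Hausdorff dimension. -/
theorem HasStrictFDerivAt.exists_nhds_dimH_fst_zeros_lt {S X Y : Type*}
    [NormedAddCommGroup S] [NormedSpace ℝ S] [FiniteDimensional ℝ S]
    [NormedAddCommGroup X] [NormedSpace ℝ X] [FiniteDimensional ℝ X]
    [NormedAddCommGroup Y] [NormedSpace ℝ Y] [FiniteDimensional ℝ Y]
    {F : S × X → Y} {F' : S × X →L[ℝ] Y} {z : S × X} (hF : HasStrictFDerivAt F F' z)
    (hsurj : Function.Surjective (F'.comp (.inl ℝ S X))) (hdim : finrank ℝ X < finrank ℝ Y) :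
    ∃ N ∈ 𝓝 z, dimH (Prod.fst '' {w ∈ N | F w = 0}) < finrank ℝ S := by
  set A : S →L[ℝ] Y := F'.comp (.inl ℝ S X) with hA
  set B : X →L[ℝ] Y := F'.comp (.inr ℝ S X) with hB
  obtain ⟨R', hR'⟩ := (A : S →ₗ[ℝ] Y).exists_rightInverse_of_surjective
    (LinearMap.range_eq_top.2 hsurj)
  set R : Y →L[ℝ] S := R'.toContinuousLinearMap
  have hR : ∀ y, A (R y) = y := fun y ↦ LinearMap.congr_fun hR' y
  set P : S →L[ℝ] A.ker := (ContinuousLinearMap.id ℝ S - R.comp A).codRestrict A.ker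
    (fun s ↦ by simp [hR]) with hP
  have hPs : ∀ s, ((P s : A.ker) : S) = s - R (A s) := fun s ↦ rfl
  let q : S × X →L[ℝ] A.ker × X := (P.comp (.fst ℝ S X)).prod (.snd ℝ S X)
  -- A left inverse of `(F', q)`: `s` is recovered from its part `P s` in `ker A` and from `A s =
  -- F'(s, x) - B x`.
  let Λ : Y × (A.ker × X) →L[ℝ] S × X :=
    ((A.ker.subtypeL.comp ((ContinuousLinearMap.fst ℝ A.ker X).comp (.snd ℝ Y _))) +
      R.comp (ContinuousLinearMap.fst ℝ Y (A.ker × X) - B.comp ((ContinuousLinearMap.snd ℝ A.ker X).comp (.snd ℝ Y _)))).prod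
      ((ContinuousLinearMap.snd ℝ A.ker X).comp (.snd ℝ Y _))
  have hsplit : ∀ s x, F' (s, x) = A s + B x := by
    intro s x
    simp only [hA, hB, ContinuousLinearMap.comp_apply, ContinuousLinearMap.inl_apply,
      ContinuousLinearMap.inr_apply, ← map_add, Prod.mk_add_mk, add_zero, zero_add]
  have hΛ : Λ.comp (F'.prod q) = ContinuousLinearMap.id ℝ (S × X) := by
    refine ContinuousLinearMap.ext fun ⟨s, x⟩ ↦ ?_
    ext1
    · simp [Λ, q, hsplit, hPs]
    · simp [Λ, q]
  have hH : HasStrictFDerivAt (fun w ↦ Λ (F w, q w))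
      (ContinuousLinearMap.id ℝ (S × X)) z := by
    have := Λ.hasStrictFDerivAt.comp z (hF.prodMk q.hasStrictFDerivAt)
    rw [hΛ] at this
    exact this
  obtain ⟨N, hN, happ⟩ : ∃ N ∈ 𝓝 z, ApproximatesLinearOn (fun w ↦ Λ (F w, q w))
      (ContinuousLinearMap.id ℝ (S × X)) N
      (1 / 2) := by
    exact hH.approximates_deriv_on_nhds (Or.inr (by norm_num))
  refine ⟨N, hN, ?_⟩
  set 𝓑 := {w ∈ N | F w = 0}
  -- On the zero set `Λ (F, q)` depends on `q` alone, and it is within `1/2` of the identity, whence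
  -- the factor `2`. So the zero set is no larger than `ker A × X`, of dimension `dim S - dim Y +
  -- dim X`.
  have hle : ∀ w ∈ 𝓑, ∀ w' ∈ 𝓑, dist w w' ≤ (2 * ‖Λ‖₊ : NNReal) * dist (q w) (q w') := by
    intro w hw w' hw'
    have h1 := happ w hw.1 w' hw'.1
    have h2 : ‖Λ (F w, q w) - Λ (F w', q w')‖ ≤ ‖Λ‖ * ‖q w - q w'‖ := by
      rw [← map_sub, hw.2, hw'.2]
      refine (Λ.le_opNorm _).trans (le_of_eq ?_)
      simp [Prod.norm_def]
    have h3 : ‖w - w'‖ ≤ ‖Λ (F w, q w) - Λ (F w', q w')‖ +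
        ‖Λ (F w, q w) - Λ (F w', q w') - (w - w')‖ := by
      rw [← norm_neg (_ - (w - w'))]
      refine le_trans (le_of_eq ?_) (norm_add_le _ _)
      congr 1; abel
    have h4 : ‖Λ (F w, q w) - Λ (F w', q w') - (w - w')‖ ≤ (1 / 2 : ℝ) * ‖w - w'‖ := by
      simpa using h1
    rw [dist_eq_norm, dist_eq_norm]
    push_cast
    linarith
  have hanti : AntilipschitzWith (2 * ‖Λ‖₊) (fun w : 𝓑 ↦ q w) :=
    AntilipschitzWith.of_le_mul_dist fun w w' ↦ hle w w.2 w' w'.2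
  have hker : finrank ℝ A.ker + finrank ℝ Y = finrank ℝ S := by
    have := (A : S →ₗ[ℝ] Y).finrank_range_add_finrank_ker
    rw [LinearMap.range_eq_top.2 hsurj, finrank_top] at this
    rw [← this, add_comm]
  calc dimH (Prod.fst '' 𝓑) ≤ dimH 𝓑 := LipschitzWith.prod_fst.dimH_image_le 𝓑
    _ = dimH (univ : Set 𝓑) := by
        rw [← (isometry_subtype_coe (s := 𝓑)).dimH_image, image_univ, Subtype.range_coe]
    _ ≤ dimH ((fun w : 𝓑 ↦ q w) '' univ) := hanti.le_dimH_image _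
    _ ≤ dimH (univ : Set (A.ker × X)) := dimH_mono (subset_univ _)
    _ = finrank ℝ (A.ker × X) := Real.dimH_univ_eq_finrank _
    _ < finrank ℝ S := by
        rw [finrank_prod]
        exact_mod_cast (by omega)

open Set Module in
/-- A form of Thom's parametric transversality theorem: when the partial derivative in the
parameter is surjective and there are more equations than unknowns, arbitrarily small parameters
remove all the zeros on a compact set. -/
theorem exists_param_forall_ne_zero {S X Y : Type*}
    [NormedAddCommGroup S] [NormedSpace ℝ S] [FiniteDimensional ℝ S]
    [NormedAddCommGroup X] [NormedSpace ℝ X] [FiniteDimensional ℝ X]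
    [NormedAddCommGroup Y] [NormedSpace ℝ Y] [FiniteDimensional ℝ Y]
    {F : S × X → Y} (hF : ContDiff ℝ 1 F) {C : Set X} (hC : IsCompact C)
    (hsurj : ∀ x ∈ C, F (0, x) = 0 →
      Function.Surjective fun s ↦ fderiv ℝ F (0, x) (s, 0))
    (hdim : finrank ℝ X < finrank ℝ Y) {O : Set S} (hO : O ∈ 𝓝 0) :
    ∃ s ∈ O, ∀ x ∈ C, F (s, x) ≠ 0 := by
  -- The empty set is listed separately because its dimension `0` is not less than `dim S` when `S`
  -- is trivial.
  have hloc : ∀ x ∈ C, ∃ V ∈ 𝓝[C] x, ∃ U ∈ 𝓝 (0 : S),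
      dimH {s ∈ U | ∃ y ∈ V, F (s, y) = 0} < finrank ℝ S ∨
        {s ∈ U | ∃ y ∈ V, F (s, y) = 0} = ∅ := by
    intro x hx
    by_cases h0 : F (0, x) = 0
    · have hst := (hF.contDiffAt (x := ((0 : S), x))).hasStrictFDerivAt one_ne_zero
      obtain ⟨N, hN, hdimN⟩ := hst.exists_nhds_dimH_fst_zeros_lt (hsurj x hx h0) hdim
      rw [nhds_prod_eq] at hN
      obtain ⟨U, hU, V, hV, hUV⟩ := Filter.mem_prod_iff.1 hN
      refine ⟨V, mem_nhdsWithin_of_mem_nhds hV, U, hU, Or.inl ((dimH_mono ?_).trans_lt hdimN)⟩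
      rintro s ⟨hs, y, hy, hzero⟩
      exact ⟨(s, y), ⟨hUV ⟨hs, hy⟩, hzero⟩, rfl⟩
    · have hN : {w | F w ≠ 0} ∈ 𝓝 ((0 : S), x) :=
        hF.continuous.continuousAt.eventually_ne h0
      rw [nhds_prod_eq] at hN
      obtain ⟨U, hU, V, hV, hUV⟩ := Filter.mem_prod_iff.1 hN
      refine ⟨V, mem_nhdsWithin_of_mem_nhds hV, U, hU, Or.inr ?_⟩
      rw [eq_empty_iff_forall_notMem]
      rintro s ⟨hs, y, hy, hzero⟩
      exact hUV (mk_mem_prod hs hy) hzero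
  obtain ⟨U, hU, hbad⟩ : ∃ U ∈ 𝓝 (0 : S), dimH {s ∈ U | ∃ y ∈ C, F (s, y) = 0} < finrank ℝ S ∨
      {s ∈ U | ∃ y ∈ C, F (s, y) = 0} = ∅ := by
    refine hC.induction_on (p := fun V ↦ ∃ U ∈ 𝓝 (0 : S),
      dimH {s ∈ U | ∃ y ∈ V, F (s, y) = 0} < finrank ℝ S ∨
        {s ∈ U | ∃ y ∈ V, F (s, y) = 0} = ∅) ?_ ?_ ?_ hloc
    · exact ⟨univ, Filter.univ_mem, Or.inr (by simp)⟩
    · rintro V V' hVV' ⟨U, hU, h⟩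
      have hsub : {s ∈ U | ∃ y ∈ V, F (s, y) = 0} ⊆ {s ∈ U | ∃ y ∈ V', F (s, y) = 0} :=
        fun s ⟨hs, y, hy, h⟩ ↦ ⟨hs, y, hVV' hy, h⟩
      exact ⟨U, hU, h.imp (fun h ↦ (dimH_mono hsub).trans_lt h) (fun h ↦ subset_eq_empty hsub h)⟩
    · rintro V V' ⟨U, hU, h⟩ ⟨U', hU', h'⟩
      refine ⟨U ∩ U', Filter.inter_mem hU hU', ?_⟩
      have hsub : {s ∈ U ∩ U' | ∃ y ∈ V ∪ V', F (s, y) = 0} ⊆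
          {s ∈ U | ∃ y ∈ V, F (s, y) = 0} ∪ {s ∈ U' | ∃ y ∈ V', F (s, y) = 0} := by
        rintro s ⟨hs, y, hy | hy, h⟩
        · exact Or.inl ⟨hs.1, y, hy, h⟩
        · exact Or.inr ⟨hs.2, y, hy, h⟩
      rcases h with h | h <;> rcases h' with h' | h'
      · left
        refine (dimH_mono hsub).trans_lt ?_
        rw [dimH_union]
        exact max_lt h h'
      · rw [h', union_empty] at hsub
        exact Or.inl ((dimH_mono hsub).trans_lt h)
      · rw [h, empty_union] at hsub
        exact Or.inl ((dimH_mono hsub).trans_lt h')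
      · rw [h, h', union_empty] at hsub
        exact Or.inr (subset_eq_empty hsub rfl)
  have hdense : Dense {s ∈ U | ∃ y ∈ C, F (s, y) = 0}ᶜ := by
    rcases hbad with h | h
    · exact dense_compl_of_dimH_lt_finrank h
    · rw [h, compl_empty]; exact dense_univ
  obtain ⟨s, hs, hs'⟩ := mem_closure_iff_nhds.1 (hdense.closure_eq ▸ mem_univ (0 : S))
    (O ∩ U) (Filter.inter_mem hO hU)
  exact ⟨s, hs.1, fun x hx h ↦ hs' ⟨hs.2, x, hx, h⟩⟩

/-! ### Iterated Lie derivatives and order of vanishing. -/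

section LieDerivative

variable {H : Type*} [NormedAddCommGroup H] [NormedSpace ℝ H]

/-- The derivative of the function `u` along the vector field `X`. -/
noncomputable def lieD (X : H → H) (u : H → ℝ) (z : H) : ℝ := fderiv ℝ u z (X z)

variable {X Y : H → H} {u v : H → ℝ} {z : H} {k l : ℕ}

theorem lieD_contDiff (hX : ContDiff ℝ ∞ X) (hu : ContDiff ℝ ∞ u) : ContDiff ℝ ∞ (lieD X u) :=
  (hu.fderiv_right (m := ∞) (by simp)).clm_apply hX

theorem iterate_lieD_contDiff (hX : ContDiff ℝ ∞ X) (hu : ContDiff ℝ ∞ u) (k : ℕ) :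
    ContDiff ℝ ∞ ((lieD X)^[k] u) := by
  induction k with
  | zero => exact hu
  | succ k ih =>
    rw [Function.iterate_succ_apply']
    exact lieD_contDiff hX ih

theorem differentiable_of_contDiff_infty {F : Type*} [NormedAddCommGroup F] [NormedSpace ℝ F]
    {f : H → F} (hf : ContDiff ℝ ∞ f) : Differentiable ℝ f :=
  hf.differentiable (by simp)

theorem lieD_add (hu : ContDiff ℝ ∞ u) (hv : ContDiff ℝ ∞ v) :
    lieD X (u + v) = lieD X u + lieD X v := by
  ext z
  simp [lieD, fderiv_add (differentiable_of_contDiff_infty hu z)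
    (differentiable_of_contDiff_infty hv z)]

theorem lieD_sub (hu : ContDiff ℝ ∞ u) (hv : ContDiff ℝ ∞ v) :
    lieD X (u - v) = lieD X u - lieD X v := by
  ext z
  simp [lieD, fderiv_sub (differentiable_of_contDiff_infty hu z)
    (differentiable_of_contDiff_infty hv z)]

theorem lieD_mul (hu : ContDiff ℝ ∞ u) (hv : ContDiff ℝ ∞ v) :
    lieD X (u * v) = lieD X u * v + u * lieD X v := by
  ext z
  simp [lieD, fderiv_mul (differentiable_of_contDiff_infty hu z)
    (differentiable_of_contDiff_infty hv z)]
  ring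

theorem lieD_const (X : H → H) (c : ℝ) : lieD X (fun _ ↦ c) = 0 := by
  ext z; simp [lieD]

theorem lieD_zero (X : H → H) : lieD X 0 = 0 := lieD_const X 0

/-- Differentiating a Lie derivative in a constant direction `e`. -/
theorem lieD_const_lieD (hX : ContDiff ℝ ∞ X) (hu : ContDiff ℝ ∞ u) (e : H) :
    lieD (fun _ ↦ e) (lieD X u) =
      lieD X (lieD (fun _ ↦ e) u) + lieD (fun z ↦ fderiv ℝ X z e) u := by
  ext z
  have hdu : DifferentiableAt ℝ (fderiv ℝ u) z :=
    differentiable_of_contDiff_infty (hu.fderiv_right (m := ∞) (by simp)) z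
  have hsymm : IsSymmSndFDerivAt ℝ u z :=
    (hu.contDiffAt).isSymmSndFDerivAt (by simpa using ENat.LEInfty.out)
  have h1 : lieD (fun _ ↦ e) (lieD X u) z =
      fderiv ℝ (fderiv ℝ u) z e (X z) + fderiv ℝ u z (fderiv ℝ X z e) := by
    have := fderiv_clm_apply hdu (differentiable_of_contDiff_infty hX z)
    change fderiv ℝ (fun z ↦ fderiv ℝ u z (X z)) z e = _
    rw [this]
    simp [add_comm]
  have h2 : lieD X (lieD (fun _ ↦ e) u) z = fderiv ℝ (fderiv ℝ u) z (X z) e := by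
    have := fderiv_clm_apply hdu (differentiableAt_const e (x := z))
    change fderiv ℝ (fun z ↦ fderiv ℝ u z e) z (X z) = _
    rw [this]
    simp
  rw [h1, Pi.add_apply, h2, hsymm e (X z)]
  rfl

/-- All iterated derivatives of `u` along smooth vector fields, fewer than `k` of them, vanish
at `z`. -/
def VanishesToOrder (z : H) : ℕ → (H → ℝ) → Prop
  | 0, _ => True
  | k + 1, u => u z = 0 ∧ ∀ X : H → H, ContDiff ℝ ∞ X → VanishesToOrder z k (lieD X u)

namespace VanishesToOrder

theorem zero (z : H) (k : ℕ) : VanishesToOrder z k 0 := by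
  induction k with
  | zero => trivial
  | succ k ih => exact ⟨rfl, fun X _ ↦ by rwa [lieD_zero]⟩

theorem of_succ (h : VanishesToOrder z (k + 1) u) : VanishesToOrder z k u := by
  induction k generalizing u with
  | zero => trivial
  | succ k ih => exact ⟨h.1, fun X hX ↦ ih (h.2 X hX)⟩

theorem mono (h : VanishesToOrder z k u) (hl : l ≤ k) : VanishesToOrder z l u := by
  induction hl with
  | refl => exact h
  | step _ ih => exact ih h.of_succ

theorem apply_eq_zero (h : VanishesToOrder z k u) (hk : 1 ≤ k) : u z = 0 := (h.mono hk).1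

theorem add (hu : ContDiff ℝ ∞ u) (hv : ContDiff ℝ ∞ v) (h : VanishesToOrder z k u)
    (h' : VanishesToOrder z k v) : VanishesToOrder z k (u + v) := by
  induction k generalizing u v with
  | zero => trivial
  | succ k ih =>
    refine ⟨by simp [h.1, h'.1], fun X hX ↦ ?_⟩
    rw [lieD_add hu hv]
    exact ih (lieD_contDiff hX hu) (lieD_contDiff hX hv) (h.2 X hX) (h'.2 X hX)

theorem mul (hu : ContDiff ℝ ∞ u) (hv : ContDiff ℝ ∞ v) (h : VanishesToOrder z k u)
    (h' : VanishesToOrder z l v) : VanishesToOrder z (k + l) (u * v) := by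
  -- The Leibniz rule lowers one of the two orders at a time, so the induction runs on their sum.
  induction hm : k + l generalizing u v k l with
  | zero => trivial
  | succ m ih =>
    refine ⟨?_, fun X hX ↦ ?_⟩
    · rcases Nat.eq_zero_or_pos k with rfl | hk
      · simp [h'.apply_eq_zero (by omega)]
      · simp [h.apply_eq_zero hk]
    · rw [lieD_mul hu hv]
      refine add ((lieD_contDiff hX hu).mul hv) (hu.mul (lieD_contDiff hX hv)) ?_ ?_
      · rcases k with _ | k
        · exact (ih (lieD_contDiff hX hu) hv (k := 0) trivial (h'.mono (l := m) (by omega))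
            (by omega))
        · exact ih (lieD_contDiff hX hu) hv (h.2 X hX) h' (by omega)
      · rcases l with _ | l
        · exact (ih hu (lieD_contDiff hX hv) (l := 0) (h.mono (l := m) (by omega)) trivial
            (by omega))
        · exact ih hu (lieD_contDiff hX hv) h (h'.2 X hX) (by omega)

theorem mul_right (hu : ContDiff ℝ ∞ u) (hv : ContDiff ℝ ∞ v) (h : VanishesToOrder z k u) :
    VanishesToOrder z k (u * v) := mul (l := 0) hu hv h trivial

theorem of_apply_eq_zero (h : u z = 0) : VanishesToOrder z 1 u := ⟨h, fun _ _ ↦ trivial⟩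

theorem pow (hu : ContDiff ℝ ∞ u) (h : u z = 0) (k : ℕ) : VanishesToOrder z k (u ^ k) := by
  induction k with
  | zero => trivial
  | succ k ih =>
    rw [pow_succ]
    exact ih.mul (hu.pow k) hu (of_apply_eq_zero h)

theorem iterate_lieD (hX : ContDiff ℝ ∞ X) (h : VanishesToOrder z (k + l) u) :
    VanishesToOrder z k ((lieD X)^[l] u) := by
  induction l generalizing u with
  | zero => exact h
  | succ l ih => exact ih (h.2 X hX)

end VanishesToOrder

theorem iterate_lieD_add (hX : ContDiff ℝ ∞ X) (hu : ContDiff ℝ ∞ u) (hv : ContDiff ℝ ∞ v)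
    (k : ℕ) : (lieD X)^[k] (u + v) = (lieD X)^[k] u + (lieD X)^[k] v := by
  induction k generalizing u v with
  | zero => rfl
  | succ k ih =>
    simp only [Function.iterate_succ_apply]
    rw [lieD_add hu hv, ih (lieD_contDiff hX hu) (lieD_contDiff hX hv)]

theorem lieD_pow (hu : ContDiff ℝ ∞ u) (k : ℕ) :
    lieD X (u ^ (k + 1)) = u ^ k * ((fun _ ↦ (k + 1 : ℝ)) * lieD X u) := by
  ext z
  simp only [lieD, Pi.mul_apply, Pi.pow_apply]
  rw [show u ^ (k + 1) = fun z ↦ u z ^ (k + 1) from rfl,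
    fderiv_fun_pow _ (differentiable_of_contDiff_infty hu z)]
  simp
  ring

/-- The leading term of the iterated derivative of `u ^ k * v` at a zero of `u`. -/
theorem iterate_lieD_pow_mul (hX : ContDiff ℝ ∞ X) (hu : ContDiff ℝ ∞ u) (hv : ContDiff ℝ ∞ v)
    (h : u z = 0) (k : ℕ) :
    (lieD X)^[k] (u ^ k * v) z = k.factorial * lieD X u z ^ k * v z := by
  induction k generalizing v with
  | zero => simp
  | succ k ih =>
    have hu' := lieD_contDiff hX hu
    have hc : ContDiff ℝ ∞ ((fun _ ↦ (k + 1 : ℝ)) * lieD X u) := contDiff_const.mul hu'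
    rw [Function.iterate_succ_apply, lieD_mul (u := u ^ (k + 1)) (hu.pow _) hv, lieD_pow hu, mul_assoc,
      iterate_lieD_add (u := u ^ k * ((fun _ ↦ (k + 1 : ℝ)) * lieD X u * v))
        (v := u ^ (k + 1) * lieD X v) hX ((hu.pow k).mul (hc.mul hv))
        ((hu.pow _).mul (lieD_contDiff hX hv)),
      Pi.add_apply, ih (v := (fun _ ↦ (k + 1 : ℝ)) * lieD X u * v) (hc.mul hv),
      VanishesToOrder.apply_eq_zero (VanishesToOrder.iterate_lieD (k := 1) hX ?_) le_rfl]
    · simp [Nat.factorial_succ]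
      ring
    · rw [add_comm]
      exact (VanishesToOrder.pow hu h _).mul_right (hu.pow _) (lieD_contDiff hX hv)

end LieDerivative

theorem hasDerivAt_add_smul {F : Type*} [NormedAddCommGroup F] [NormedSpace ℝ F] (p w : F) :
    HasDerivAt (fun t : ℝ ↦ p + t • w) w 0 := by
  have := ((hasDerivAt_id' (0 : ℝ)).smul_const w).const_add p
  rwa [one_smul] at this

/-! ### The equations of motion as a vector field, with the potential depending on parameters. -/

section MechanicalField

variable {E : Type*} [NormedAddCommGroup E] [NormedSpace ℝ E]
  {Γ : E × E → E} {A : E → (E →L[ℝ] ℝ) →L[ℝ] E} {G U V : E → ℝ}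

/-- The first-order vector field of the equation `c'' = Γ(c, c') - A(c) DV(c)`. -/
noncomputable def mechField (Γ : E × E → E) (A : E → (E →L[ℝ] ℝ) →L[ℝ] E) (V : E → ℝ)
    (x : E × E) : E × E :=
  (x.2, Γ x - A x.1 (fderiv ℝ V x.1))

/-- The derivatives of `G` along the solutions of `c'' = Γ(c, c') - A(c) DV(c)`: the `j`-th of
these functions is the derivative of order `j + 1`, as a function of position and velocity. -/
noncomputable def derivAlong (Γ : E × E → E) (A : E → (E →L[ℝ] ℝ) →L[ℝ] E) (G V : E → ℝ)
    (j : ℕ) : E × E → ℝ :=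
  (lieD (mechField Γ A V))^[j] fun x ↦ fderiv ℝ G x.1 x.2

theorem contDiff_fderiv_infty {F : Type*} [NormedAddCommGroup F] [NormedSpace ℝ F] {f : E → F}
    (hf : ContDiff ℝ ∞ f) : ContDiff ℝ ∞ (fderiv ℝ f) :=
  hf.fderiv_right (by simp)

theorem mechField_contDiff (hΓ : ContDiff ℝ ∞ Γ) (hA : ContDiff ℝ ∞ A) (hV : ContDiff ℝ ∞ V) :
    ContDiff ℝ ∞ (mechField Γ A V) :=
  contDiff_snd.prodMk (hΓ.sub ((hA.comp contDiff_fst).clm_apply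
    ((contDiff_fderiv_infty hV).comp contDiff_fst)))

theorem contDiff_fderiv_fst_apply_snd (hG : ContDiff ℝ ∞ G) :
    ContDiff ℝ ∞ fun x : E × E ↦ fderiv ℝ G x.1 x.2 :=
  ((contDiff_fderiv_infty hG).comp contDiff_fst).clm_apply contDiff_snd

theorem derivAlong_contDiff (hΓ : ContDiff ℝ ∞ Γ) (hA : ContDiff ℝ ∞ A) (hG : ContDiff ℝ ∞ G)
    (hV : ContDiff ℝ ∞ V) (j : ℕ) : ContDiff ℝ ∞ (derivAlong Γ A G V j) :=
  iterate_lieD_contDiff (mechField_contDiff hΓ hA hV) (contDiff_fderiv_fst_apply_snd hG) j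

variable {ι : Type*} [Fintype ι] {P : ι → E → ℝ}

/-- The vector fields of the potentials `U + ∑ c, s c • P c`, as one vector field on the product
with the space of parameters `s`. -/
noncomputable def paramField (Γ : E × E → E) (A : E → (E →L[ℝ] ℝ) →L[ℝ] E) (U : E → ℝ)
    (P : ι → E → ℝ) (z : (ι → ℝ) × (E × E)) : (ι → ℝ) × (E × E) :=
  (0, (z.2.2, Γ z.2 - A z.2.1 (fderiv ℝ U z.2.1 + ∑ c, z.1 c • fderiv ℝ (P c) z.2.1)))

/-- The derivatives of `G` along solutions, as functions also of the parameters. -/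
noncomputable def paramDerivAlong (Γ : E × E → E) (A : E → (E →L[ℝ] ℝ) →L[ℝ] E) (G U : E → ℝ)
    (P : ι → E → ℝ) (j : ℕ) : (ι → ℝ) × (E × E) → ℝ :=
  (lieD (paramField Γ A U P))^[j] fun z ↦ fderiv ℝ G z.2.1 z.2.2

theorem paramField_contDiff (hΓ : ContDiff ℝ ∞ Γ) (hA : ContDiff ℝ ∞ A) (hU : ContDiff ℝ ∞ U)
    (hP : ∀ c, ContDiff ℝ ∞ (P c)) : ContDiff ℝ ∞ (paramField Γ A U P) := by
  have hy : ContDiff ℝ ∞ fun z : (ι → ℝ) × (E × E) ↦ z.2.1 := contDiff_fst.comp contDiff_snd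
  refine contDiff_const.prodMk ((contDiff_snd.comp contDiff_snd).prodMk
    ((hΓ.comp contDiff_snd).sub ((hA.comp hy).clm_apply
      (((contDiff_fderiv_infty hU).comp hy).add (ContDiff.sum fun c _ ↦ ?_)))))
  exact ((contDiff_apply ℝ ℝ c).comp contDiff_fst).smul
    ((contDiff_fderiv_infty (hP c)).comp hy)

theorem contDiff_fderiv_snd_apply (hG : ContDiff ℝ ∞ G) :
    ContDiff ℝ ∞ fun z : (ι → ℝ) × (E × E) ↦ fderiv ℝ G z.2.1 z.2.2 :=
  (contDiff_fderiv_fst_apply_snd hG).comp contDiff_snd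

theorem paramDerivAlong_contDiff (hΓ : ContDiff ℝ ∞ Γ) (hA : ContDiff ℝ ∞ A)
    (hG : ContDiff ℝ ∞ G) (hU : ContDiff ℝ ∞ U) (hP : ∀ c, ContDiff ℝ ∞ (P c)) (j : ℕ) :
    ContDiff ℝ ∞ (paramDerivAlong Γ A G U P j) :=
  iterate_lieD_contDiff (paramField_contDiff hΓ hA hU hP) (contDiff_fderiv_snd_apply hG) j

theorem fderiv_add_sum_smul (hU : ContDiff ℝ ∞ U) (hP : ∀ c, ContDiff ℝ ∞ (P c)) (s : ι → ℝ)
    (y : E) : fderiv ℝ (fun y ↦ U y + ∑ c, s c * P c y) y =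
      fderiv ℝ U y + ∑ c, s c • fderiv ℝ (P c) y := by
  refine HasFDerivAt.fderiv ?_
  exact (differentiable_of_contDiff_infty hU y).hasFDerivAt.add (HasFDerivAt.fun_sum fun c _ ↦
    (differentiable_of_contDiff_infty (hP c) y).hasFDerivAt.const_mul (s c))

/-- The extended field has no component along the parameters, so its Lie derivatives are computed on
each slice of constant `s`. -/
theorem paramDerivAlong_apply (hΓ : ContDiff ℝ ∞ Γ) (hA : ContDiff ℝ ∞ A)
    (hG : ContDiff ℝ ∞ G) (hU : ContDiff ℝ ∞ U) (hP : ∀ c, ContDiff ℝ ∞ (P c)) (j : ℕ)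
    (s : ι → ℝ) (x : E × E) :
    paramDerivAlong Γ A G U P j (s, x) =
      derivAlong Γ A G (fun y ↦ U y + ∑ c, s c * P c y) j x := by
  induction j generalizing x with
  | zero => rfl
  | succ j ih =>
    rw [paramDerivAlong, derivAlong, Function.iterate_succ_apply', Function.iterate_succ_apply',
      ← paramDerivAlong, ← derivAlong]
    have hd := differentiable_of_contDiff_infty (paramDerivAlong_contDiff hΓ hA hG hU hP j) (s, x)
    have h1 : HasFDerivAt (fun x ↦ paramDerivAlong Γ A G U P j (s, x))
        ((fderiv ℝ (paramDerivAlong Γ A G U P j) (s, x)).comp (.inr ℝ (ι → ℝ) (E × E))) x :=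
      hd.hasFDerivAt.comp x (hasFDerivAt_prodMk_right s x)
    simp only [ih] at h1
    rw [lieD, lieD, h1.fderiv, mechField, fderiv_add_sum_smul hU hP]
    rfl

/-- The field is affine in the parameters, so its derivative in a direction `σ` is the force of the
potential `∑ c, σ c * P c`. -/
theorem fderiv_paramField_inl (hΓ : ContDiff ℝ ∞ Γ) (hA : ContDiff ℝ ∞ A) (hU : ContDiff ℝ ∞ U)
    (hP : ∀ c, ContDiff ℝ ∞ (P c)) (σ : ι → ℝ) (z : (ι → ℝ) × (E × E)) :
    fderiv ℝ (paramField Γ A U P) z (σ, 0) =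
      (0, (0, -A z.2.1 (fderiv ℝ (fun y ↦ ∑ c, σ c * P c y) z.2.1))) := by
  have h1 := ((differentiable_of_contDiff_infty (paramField_contDiff hΓ hA hU hP)
    z).hasFDerivAt).hasLineDerivAt (σ, 0)
  have h2 : fderiv ℝ (fun y ↦ ∑ c, σ c * P c y) z.2.1 = ∑ c, σ c • fderiv ℝ (P c) z.2.1 :=
    HasFDerivAt.fderiv (HasFDerivAt.fun_sum fun c _ ↦
      (differentiable_of_contDiff_infty (hP c) _).hasFDerivAt.const_mul (σ c))
  have h3 : (fun t : ℝ ↦ paramField Γ A U P (z + t • (σ, 0))) = fun t ↦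
      paramField Γ A U P z +
        t • ((0, (0, -A z.2.1 (∑ c, σ c • fderiv ℝ (P c) z.2.1))) : (ι → ℝ) × (E × E)) := by
    funext t
    simp only [paramField, Prod.fst_add, Prod.snd_add, Prod.smul_mk, smul_zero, add_zero,
      Pi.add_apply, Pi.smul_apply, Prod.mk_add_mk, smul_eq_mul, add_smul, mul_smul,
      Finset.sum_add_distrib, ← Finset.smul_sum, map_add, map_smul, smul_neg]
    congr 2
    abel
  rw [h2]
  refine h1.unique ?_
  rw [HasLineDerivAt, h3]
  exact hasDerivAt_add_smul _ _

end MechanicalField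

/-! ### First-order effect of a perturbation `a ^ m * b` on the derivatives along solutions. -/

section LeadingTerm

variable {E : Type*} [NormedAddCommGroup E] [NormedSpace ℝ E]
  {Γ : E × E → E} {A : E → (E →L[ℝ] ℝ) →L[ℝ] E} {G U : E → ℝ}
  {ι : Type*} [Fintype ι] {P : ι → E → ℝ} {σ : ι → ℝ} {m : ℕ} {a b : E → ℝ}

theorem contDiff_comp_position {f : E → ℝ} (hf : ContDiff ℝ ∞ f) :
    ContDiff ℝ ∞ fun z : (ι → ℝ) × (E × E) ↦ f z.2.1 :=
  hf.comp (contDiff_fst.comp contDiff_snd)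

theorem fderiv_pow_mul (ha : ContDiff ℝ ∞ a) (hb : ContDiff ℝ ∞ b) (m : ℕ) (y : E) :
    fderiv ℝ (fun y ↦ a y ^ m * b y) y =
      a y ^ m • fderiv ℝ b y + (a y ^ (m - 1) * b y * m) • fderiv ℝ a y := by
  have h1 := (differentiable_of_contDiff_infty ha y).hasFDerivAt.pow m
  have h2 := (h1.mul (differentiable_of_contDiff_infty hb y).hasFDerivAt).fderiv
  refine h2.trans ?_
  congr 1
  ext w
  simp
  ring

/-- The derivative of `u` along the perturbation of the field has the same order of vanishing
as the derivative of the perturbing potential `a ^ m * b`. -/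
theorem vanishesToOrder_lieD_perturbation (hA : ContDiff ℝ ∞ A) (ha : ContDiff ℝ ∞ a)
    (hb : ContDiff ℝ ∞ b) {z : (ι → ℝ) × (E × E)} (haz : a z.2.1 = 0) (hbz : b z.2.1 = 0)
    {u : (ι → ℝ) × (E × E) → ℝ} (hu : ContDiff ℝ ∞ u) :
    VanishesToOrder z m (lieD (fun z ↦
      ((0, (0, -A z.2.1 (fderiv ℝ (fun y ↦ a y ^ m * b y) z.2.1))) : (ι → ℝ) × (E × E))) u) := by
  have hy : ContDiff ℝ ∞ fun z : (ι → ℝ) × (E × E) ↦ z.2.1 := contDiff_fst.comp contDiff_snd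
  have hterm : ∀ f : E → ℝ, ContDiff ℝ ∞ f → ContDiff ℝ ∞ (lieD (fun z ↦
      ((0, (0, -A z.2.1 (fderiv ℝ f z.2.1))) : (ι → ℝ) × (E × E))) u) := by
    intro f hf
    exact lieD_contDiff (contDiff_const.prodMk (contDiff_const.prodMk
      ((hA.comp hy).clm_apply ((contDiff_fderiv_infty hf).comp hy)).neg)) hu
  have heq : lieD (fun z ↦ ((0, (0, -A z.2.1 (fderiv ℝ (fun y ↦ a y ^ m * b y) z.2.1))) :
      (ι → ℝ) × (E × E))) u =
      (fun z ↦ a z.2.1) ^ m * lieD (fun z ↦ (0, (0, -A z.2.1 (fderiv ℝ b z.2.1)))) u +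
      ((fun z ↦ a z.2.1) ^ (m - 1) * (fun z ↦ b z.2.1)) * ((fun _ ↦ (m : ℝ)) *
        lieD (fun z ↦ (0, (0, -A z.2.1 (fderiv ℝ a z.2.1)))) u) := by
    ext z
    simp only [lieD, Pi.add_apply, Pi.mul_apply, Pi.pow_apply]
    rw [fderiv_pow_mul ha hb]
    have : ∀ r t : ℝ, ∀ ξ η : E →L[ℝ] ℝ, ((0, (0, -A z.2.1 (r • ξ + t • η))) :
        (ι → ℝ) × (E × E)) = r • (0, (0, -A z.2.1 ξ)) + t • (0, (0, -A z.2.1 η)) := by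
      intro r t ξ η
      simp only [map_add, map_smul, Prod.smul_mk, Prod.mk_add_mk, smul_zero, add_zero, smul_neg]
      congr 2; abel
    rw [this, map_add, map_smul, map_smul, smul_eq_mul, smul_eq_mul]
    ring
  rw [heq]
  have ha' := contDiff_comp_position (ι := ι) ha
  have hb' := contDiff_comp_position (ι := ι) hb
  have h1 := VanishesToOrder.pow ha' haz
  refine VanishesToOrder.add ((ha'.pow m).mul (hterm b hb))
    (((ha'.pow _).mul hb').mul (contDiff_const.mul (hterm a ha))) ?_ ?_
  · exact (h1 m).mul_right (ha'.pow m) (hterm b hb)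
  -- The factor `b` restores the order lost in `a ^ (m - 1)`; for `m = 0` the truncated subtraction
  -- does no harm.
  · have h2 : VanishesToOrder z (m - 1 + 1)
        ((fun z ↦ a z.2.1) ^ (m - 1) * (fun z ↦ b z.2.1)) :=
      (h1 (m - 1)).mul (ha'.pow _) hb' (VanishesToOrder.of_apply_eq_zero hbz)
    exact (h2.mono (by omega)).mul_right ((ha'.pow _).mul hb')
      (contDiff_const.mul (hterm a ha))

variable (hΓ : ContDiff ℝ ∞ Γ) (hA : ContDiff ℝ ∞ A) (hG : ContDiff ℝ ∞ G) (hU : ContDiff ℝ ∞ U)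
  (hP : ∀ c, ContDiff ℝ ∞ (P c)) (ha : ContDiff ℝ ∞ a) (hb : ContDiff ℝ ∞ b)
  (hσ : ∀ y, ∑ c, σ c * P c y = a y ^ m * b y)

-- The commutator of `∂_σ` with the field is the perturbing force. Differentiating the recursion for
-- the derivatives along solutions in the direction `σ` therefore adds one source term at each step.
include hΓ hA hG hU hP hσ in
theorem lieD_paramDerivAlong_succ (j : ℕ) :
    lieD (fun _ ↦ (σ, 0)) (paramDerivAlong Γ A G U P (j + 1)) =
      lieD (paramField Γ A U P) (lieD (fun _ ↦ (σ, 0)) (paramDerivAlong Γ A G U P j)) +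
      lieD (fun z ↦ (0, (0, -A z.2.1 (fderiv ℝ (fun y ↦ a y ^ m * b y) z.2.1))))
        (paramDerivAlong Γ A G U P j) := by
  rw [paramDerivAlong, Function.iterate_succ_apply', ← paramDerivAlong,
    lieD_const_lieD (paramField_contDiff hΓ hA hU hP)
      (paramDerivAlong_contDiff hΓ hA hG hU hP j)]
  simp only [fderiv_paramField_inl hΓ hA hU hP, hσ]

-- The first derivative `dG(v)` does not involve the potential.
include hG in
theorem lieD_paramDerivAlong_zero :
    lieD (fun _ ↦ (σ, 0)) (paramDerivAlong Γ A G U P 0) = 0 := by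
  ext z
  have h1 := ((differentiable_of_contDiff_infty (contDiff_fderiv_snd_apply (ι := ι) hG)
    z).hasFDerivAt).hasLineDerivAt (σ, 0)
  refine h1.unique ?_
  simpa [HasLineDerivAt] using hasDerivAt_const (0 : ℝ) _

-- In the recursion each source term vanishes to order `m` and each derivative along the field costs
-- one order, which leaves order `m + 1 - j`.
include hΓ hA hG hU hP ha hb hσ in
theorem vanishesToOrder_lieD_paramDerivAlong {z : (ι → ℝ) × (E × E)} (haz : a z.2.1 = 0)
    (hbz : b z.2.1 = 0) (j k : ℕ) (hjk : k + j ≤ m + 1) :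
    VanishesToOrder z k (lieD (fun _ ↦ (σ, 0)) (paramDerivAlong Γ A G U P j)) := by
  have hF := paramDerivAlong_contDiff hΓ hA hG hU hP
  have hX := paramField_contDiff hΓ hA hU hP
  have hp : ContDiff ℝ ∞ fun y ↦ a y ^ m * b y := (ha.pow m).mul hb
  have hy : ContDiff ℝ ∞ fun z : (ι → ℝ) × (E × E) ↦ z.2.1 := contDiff_fst.comp contDiff_snd
  induction j generalizing k with
  | zero =>
    rw [lieD_paramDerivAlong_zero hG]
    exact VanishesToOrder.zero z k
  | succ j ih =>
    rw [lieD_paramDerivAlong_succ hΓ hA hG hU hP hσ]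
    refine VanishesToOrder.add (lieD_contDiff hX (lieD_contDiff contDiff_const (hF j)))
      (lieD_contDiff (contDiff_const.prodMk (contDiff_const.prodMk ((hA.comp hy).clm_apply
        ((contDiff_fderiv_infty hp).comp hy)).neg)) (hF j)) ?_ ?_
    · exact (ih (k + 1) (by omega)).2 _ hX
    · exact (vanishesToOrder_lieD_perturbation hA ha hb haz hbz (hF j)).mono (by omega)

include hΓ hA hG hU hP ha hb hσ in
/-- The first derivative along solutions that feels the perturbation `a ^ m * b` of the
potential is the one of order `m + 2`. -/
theorem fderiv_paramDerivAlong_apply (hsymm : ∀ y, ∀ ξ η : E →L[ℝ] ℝ, ξ (A y η) = η (A y ξ))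
    {z : (ι → ℝ) × (E × E)} (haz : a z.2.1 = 0) (hbz : b z.2.1 = 0)
    (haw : fderiv ℝ a z.2.1 (A z.2.1 (fderiv ℝ G z.2.1)) = 0) :
    fderiv ℝ (paramDerivAlong Γ A G U P (m + 1)) z (σ, 0) =
      -(m.factorial * fderiv ℝ a z.2.1 z.2.2 ^ m *
        fderiv ℝ b z.2.1 (A z.2.1 (fderiv ℝ G z.2.1))) := by
  have hF := paramDerivAlong_contDiff hΓ hA hG hU hP
  have hX := paramField_contDiff hΓ hA hU hP
  have hp : ContDiff ℝ ∞ fun y ↦ a y ^ m * b y := (ha.pow m).mul hb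
  have hy : ContDiff ℝ ∞ fun z : (ι → ℝ) × (E × E) ↦ z.2.1 := contDiff_fst.comp contDiff_snd
  set W : (ι → ℝ) × (E × E) → (ι → ℝ) × (E × E) :=
    fun z ↦ (0, (0, -A z.2.1 (fderiv ℝ (fun y ↦ a y ^ m * b y) z.2.1))) with hWdef
  have hW : ContDiff ℝ ∞ W := contDiff_const.prodMk (contDiff_const.prodMk
    ((hA.comp hy).clm_apply ((contDiff_fderiv_infty hp).comp hy)).neg)
  set X := paramField Γ A U P
  have hW0 := lieD_contDiff hW (hF 0)
  -- Up to order `m + 2` only the first source term counts. The later ones also vanish to order `m`,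
  -- but are differentiated fewer than `m` times.
  have hdiff : ∀ j k, k + j ≤ m + 1 → VanishesToOrder z k
      (lieD (fun _ ↦ (σ, 0)) (paramDerivAlong Γ A G U P (j + 1)) -
        (lieD X)^[j] (lieD W (paramDerivAlong Γ A G U P 0))) := by
    intro j
    induction j with
    | zero =>
      intro k _
      rw [lieD_paramDerivAlong_succ hΓ hA hG hU hP hσ, lieD_paramDerivAlong_zero hG, lieD_zero,
        zero_add, Function.iterate_zero, id, sub_self]
      exact VanishesToOrder.zero z k
    | succ j ih =>
      intro k hk
      have hs := lieD_contDiff (X := fun _ ↦ (σ, 0)) contDiff_const (hF (j + 1))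
      have hi := iterate_lieD_contDiff hX hW0 j
      rw [lieD_paramDerivAlong_succ hΓ hA hG hU hP hσ, Function.iterate_succ_apply',
        add_sub_right_comm, ← lieD_sub hs hi]
      refine VanishesToOrder.add (lieD_contDiff hX (hs.sub hi)) (lieD_contDiff hW (hF _)) ?_ ?_
      · exact (ih (k + 1) (by omega)).2 _ hX
      · exact (vanishesToOrder_lieD_perturbation hA ha hb haz hbz (hF _)).mono (by omega)
  have h1 := (hdiff m 1 (by omega)).apply_eq_zero le_rfl
  rw [Pi.sub_apply, sub_eq_zero] at h1
  have ha' := contDiff_comp_position (ι := ι) ha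
  have hb' := contDiff_comp_position (ι := ι) hb
  have hw : ∀ f : E → ℝ, ContDiff ℝ ∞ f → ContDiff ℝ ∞
      fun z : (ι → ℝ) × (E × E) ↦ fderiv ℝ f z.2.1 (A z.2.1 (fderiv ℝ G z.2.1)) := fun f hf ↦
    ((contDiff_fderiv_infty hf).comp hy).clm_apply
      ((hA.comp hy).clm_apply ((contDiff_fderiv_infty hG).comp hy))
  -- By symmetry of `A` this is `-d(a ^ m * b)` applied to the gradient of `G`. In the part
  -- containing `da`, the factors `b` and `da(grad G)` both vanish at `z`, so that part vanishes to
  -- order `m + 1` and `m` derivatives do not reveal it.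
  have hWF : lieD W (paramDerivAlong Γ A G U P 0) =
      (fun z ↦ a z.2.1) ^ m * -(fun z ↦ fderiv ℝ b z.2.1 (A z.2.1 (fderiv ℝ G z.2.1))) +
      ((fun z ↦ a z.2.1) ^ (m - 1) * (fun z ↦ b z.2.1)) *
        (fun z ↦ fderiv ℝ a z.2.1 (A z.2.1 (fderiv ℝ G z.2.1))) * (fun _ ↦ -(m : ℝ)) := by
    ext z
    have h2 : lieD W (paramDerivAlong Γ A G U P 0) z = fderiv ℝ G z.2.1 (W z).2.2 := by
      have h3 := ((differentiable_of_contDiff_infty (contDiff_fderiv_snd_apply (ι := ι) hG)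
        z).hasFDerivAt).hasLineDerivAt (W z)
      refine h3.unique ?_
      have h4 : (fun t : ℝ ↦ fderiv ℝ G (z + t • W z).2.1 (z + t • W z).2.2) = fun t ↦
          fderiv ℝ G z.2.1 z.2.2 + t • fderiv ℝ G z.2.1 (W z).2.2 := by
        funext t
        simp [hWdef]
      rw [HasLineDerivAt, h4]
      exact hasDerivAt_add_smul _ _
    rw [h2]
    simp only [hWdef, map_neg, hsymm _ (fderiv ℝ G z.2.1), fderiv_pow_mul ha hb]
    simp
    ring
  have h5 : (lieD X)^[m] (lieD W (paramDerivAlong Γ A G U P 0)) z =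
      -(m.factorial * fderiv ℝ a z.2.1 z.2.2 ^ m *
        fderiv ℝ b z.2.1 (A z.2.1 (fderiv ℝ G z.2.1))) := by
    have hu1 := (ha'.pow m).mul (hw b hb).neg
    have hu2 := ((ha'.pow (m - 1)).mul hb').mul (hw a ha)
    have hv : VanishesToOrder z (1 + m)
        (((fun z ↦ a z.2.1) ^ (m - 1) * (fun z ↦ b z.2.1)) *
        (fun z ↦ fderiv ℝ a z.2.1 (A z.2.1 (fderiv ℝ G z.2.1))) * (fun _ ↦ -(m : ℝ))) := by
      refine VanishesToOrder.mul_right hu2 contDiff_const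
        (VanishesToOrder.mono (k := m - 1 + 1 + 1) ?_ (by omega))
      exact ((VanishesToOrder.pow ha' haz (m - 1)).mul (ha'.pow _) hb'
        (VanishesToOrder.of_apply_eq_zero hbz)).mul ((ha'.pow _).mul hb') (hw a ha)
        (VanishesToOrder.of_apply_eq_zero haw)
    have h6 := (VanishesToOrder.iterate_lieD (k := 1) (l := m) hX hv).apply_eq_zero le_rfl
    have h7 := iterate_lieD_pow_mul (z := z) hX ha' (hw b hb).neg haz m
    have h8 : lieD X (fun z ↦ a z.2.1) z = fderiv ℝ a z.2.1 z.2.2 := by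
      have h9 : HasFDerivAt (fun z : (ι → ℝ) × (E × E) ↦ a z.2.1)
          ((fderiv ℝ a z.2.1).comp ((ContinuousLinearMap.fst ℝ E E).comp (.snd ℝ _ _))) z :=
        (differentiable_of_contDiff_infty ha z.2.1).hasFDerivAt.comp z
          (hasFDerivAt_fst.comp z hasFDerivAt_snd)
      rw [lieD, h9.fderiv]
      rfl
    rw [hWF]
    refine (congrFun (iterate_lieD_add hX hu1 (hu2.mul contDiff_const) m) z).trans ?_
    refine (congrArg₂ (· + ·) h7 h6).trans ?_
    rw [h8]
    ring
  exact h1.trans h5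

end LeadingTerm

/-! ### A finite-dimensional family of polynomial perturbations. -/

/-- The matrix with rows `L (σ m)` is upper triangular with nonzero diagonal, hence invertible. -/
theorem LinearMap.surjective_of_triangular {S : Type*} [AddCommGroup S] [Module ℝ S] {N : ℕ}
    (L : S →ₗ[ℝ] (Fin N → ℝ)) (σ : Fin N → S) (h0 : ∀ m j, j < m → L (σ m) j = 0)
    (h1 : ∀ m, L (σ m) m ≠ 0) : Function.Surjective L := by
  set M : Matrix (Fin N) (Fin N) ℝ := Matrix.of fun m j ↦ L (σ m) j
  have hdet : IsUnit M.det := by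
    rw [Matrix.det_of_isUpperTriangular (M := M) fun i j hij ↦ h0 i j hij]
    exact (Finset.prod_ne_zero_iff.2 fun m _ ↦ h1 m).isUnit
  intro c
  refine ⟨∑ m, (Matrix.vecMul c M⁻¹) m • σ m, ?_⟩
  have : Matrix.vecMul (Matrix.vecMul c M⁻¹) M = c := by
    rw [Matrix.vecMul_vecMul, Matrix.nonsing_inv_mul _ hdet, Matrix.vecMul_one]
  rw [map_sum]
  conv_rhs => rw [← this]
  ext j
  simp [Matrix.vecMul, dotProduct, M]

/-- The monomials of degree at most `d` in the coordinates, with repetitions: the factor indexed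
by `none` is `1`. -/
def coordMonomial {n d : ℕ} (c : Fin d → Option (Fin n)) (y : EuclideanSpace ℝ (Fin n)) : ℝ :=
  ∏ k, (c k).elim 1 fun i ↦ y i

theorem coordMonomial_contDiff {n d : ℕ} (c : Fin d → Option (Fin n)) :
    ContDiff ℝ ∞ (coordMonomial c) := by
  refine contDiff_prod fun k _ ↦ ?_
  cases c k with
  | none => exact contDiff_const
  | some i => exact contDiff_euclidean.1 contDiff_id i

/-- Allowing the factor `1` makes a product of `d` affine functions expand without any bookkeeping
of degrees. -/
theorem prod_affine_eq_sum_coordMonomial {n d : ℕ} (b : Fin d → Option (Fin n) → ℝ)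
    (y : EuclideanSpace ℝ (Fin n)) :
    ∏ k, (b k none + ∑ i, b k (some i) * y i) =
      ∑ c : Fin d → Option (Fin n), (∏ k, b k (c k)) * coordMonomial c y := by
  have : ∀ k, b k none + ∑ i, b k (some i) * y i =
      ∑ o : Option (Fin n), b k o * o.elim 1 fun i ↦ y i := by
    intro k
    simp [Fintype.sum_option]
  simp_rw [this, Finset.prod_univ_sum, coordMonomial, Finset.prod_mul_distrib,
    Fintype.piFinset_univ]

theorem clm_apply_sub_eq_affine {n : ℕ} (α : EuclideanSpace ℝ (Fin n) →L[ℝ] ℝ)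
    (y y₀ : EuclideanSpace ℝ (Fin n)) :
    α (y - y₀) = -α y₀ + ∑ i, α (EuclideanSpace.single i 1) * y i := by
  have h : α y = ∑ i, α (EuclideanSpace.single i 1) * y i := by
    conv_lhs => rw [← (EuclideanSpace.basisFun (Fin n) ℝ).sum_repr y, map_sum]
    simp [mul_comm]
  rw [map_sub, h]
  ring

/-- One family of monomials thus contains the required perturbations for every base point and every
pair of linear forms at once, which the compactness argument needs. -/
theorem exists_sum_coordMonomial_eq_pow_mul {n d : ℕ}
    (α β : EuclideanSpace ℝ (Fin n) →L[ℝ] ℝ) (y₀ : EuclideanSpace ℝ (Fin n)) (m : Fin d) :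
    ∃ s : (Fin d → Option (Fin n)) → ℝ, ∀ y,
      ∑ c, s c * coordMonomial c y = α (y - y₀) ^ (m : ℕ) * β (y - y₀) := by
  let f : (EuclideanSpace ℝ (Fin n) →L[ℝ] ℝ) → Option (Fin n) → ℝ := fun α o ↦
    o.elim (-α y₀) fun i ↦ α (EuclideanSpace.single i 1)
  -- The `m` factors `α` and one factor `β` are padded with constants `1` to `d` factors; `m < d`
  -- leaves room for `β`.
  let b : Fin d → Option (Fin n) → ℝ := fun k ↦
    if k < m then f α else if k = m then f β else fun o ↦ o.elim 1 fun _ ↦ 0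
  refine ⟨fun c ↦ ∏ k, b k (c k), fun y ↦ ?_⟩
  rw [← prod_affine_eq_sum_coordMonomial]
  have h : ∀ k, b k none + ∑ i, b k (some i) * y i =
      (if k < m then α (y - y₀) else 1) * if k = m then β (y - y₀) else 1 := by
    intro k
    rcases lt_trichotomy k m with hk | hk | hk
    · simp [b, f, hk, hk.ne, clm_apply_sub_eq_affine α y y₀]
    · simp [b, f, hk, clm_apply_sub_eq_affine β y y₀]
    · simp [b, hk.ne', not_lt.2 hk.le]
  simp_rw [h, Finset.prod_mul_distrib]
  rw [Finset.prod_ite_eq' Finset.univ m, Finset.prod_ite,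
    show Finset.univ.filter (fun k ↦ k < m) = Finset.Iio m by ext; simp]
  simp

theorem exists_clm_eq_one_eq_zero {E : Type*} [NormedAddCommGroup E] [NormedSpace ℝ E]
    [FiniteDimensional ℝ E] {v w : E} (h : v ∉ Submodule.span ℝ {w}) :
    ∃ α : E →L[ℝ] ℝ, α v = 1 ∧ α w = 0 := by
  obtain ⟨f, hf, hfw⟩ := Submodule.exists_le_ker_of_notMem h
  refine ⟨(f v)⁻¹ • LinearMap.toContinuousLinearMap f, ?_, ?_⟩
  · simp [hf]
  · have : f w = 0 := hfw (Submodule.mem_span_singleton_self w)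
    simp [this]

open Module in
/-- A small polynomial perturbation of the potential `U` excludes every velocity of a compact set
at which the derivatives of `G` along solutions vanish to high order. -/
theorem exists_param_derivAlong_ne_zero {n : ℕ}
    {Γ : EuclideanSpace ℝ (Fin n) × EuclideanSpace ℝ (Fin n) → EuclideanSpace ℝ (Fin n)}
    {A : EuclideanSpace ℝ (Fin n) →
      (EuclideanSpace ℝ (Fin n) →L[ℝ] ℝ) →L[ℝ] EuclideanSpace ℝ (Fin n)}
    {G U θ : EuclideanSpace ℝ (Fin n) → ℝ}
    (hΓ : ContDiff ℝ ∞ Γ) (hA : ContDiff ℝ ∞ A) (hG : ContDiff ℝ ∞ G) (hU : ContDiff ℝ ∞ U)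
    (hθ : ContDiff ℝ ∞ θ)
    (hsymm : ∀ y, ∀ ξ η : EuclideanSpace ℝ (Fin n) →L[ℝ] ℝ, ξ (A y η) = η (A y ξ))
    {C : Set (EuclideanSpace ℝ (Fin n) × EuclideanSpace ℝ (Fin n))} (hC : IsCompact C)
    (hCθ : ∀ x ∈ C, θ x.1 = 1) (hCv : ∀ x ∈ C, x.2 ≠ 0)
    (hCG : ∀ x ∈ C, fderiv ℝ G x.1 (A x.1 (fderiv ℝ G x.1)) ≠ 0)
    {O : Set ((Fin (2 * n + 1) → Option (Fin n)) → ℝ)} (hO : O ∈ 𝓝 0) :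
    ∃ s ∈ O, ∀ x ∈ C, ∃ j ≤ 2 * n + 1,
      derivAlong Γ A G (fun y ↦ U y + ∑ c, s c * (θ y * coordMonomial c y)) j x ≠ 0 := by
  set P : (Fin (2 * n + 1) → Option (Fin n)) → EuclideanSpace ℝ (Fin n) → ℝ :=
    fun c y ↦ θ y * coordMonomial c y
  have hP : ∀ c, ContDiff ℝ ∞ (P c) := fun c ↦ hθ.mul (coordMonomial_contDiff c)
  have hF := paramDerivAlong_contDiff hΓ hA hG hU hP
  -- The shift by one starts at the second derivative of `G`, the first to depend on the potential.
  -- Entry `m` is the first one to feel `α ^ m * β`.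
  let Φ : ((Fin (2 * n + 1) → Option (Fin n)) → ℝ) ×
      (EuclideanSpace ℝ (Fin n) × EuclideanSpace ℝ (Fin n)) → (Fin (2 * n + 1) → ℝ) :=
    fun z j ↦ paramDerivAlong Γ A G U P (j + 1) z
  have hΦ : ContDiff ℝ ∞ Φ := contDiff_pi.2 fun j ↦ hF _
  -- Elsewhere on `C` the first derivative is already nonzero, whatever the parameters.
  set C' := C ∩ {x | fderiv ℝ G x.1 x.2 = 0}
  have hC' : IsCompact C' := hC.inter_right
    (isClosed_eq (contDiff_fderiv_fst_apply_snd hG).continuous continuous_const)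
  have hsurj : ∀ x ∈ C', Φ (0, x) = 0 → Function.Surjective fun s ↦ fderiv ℝ Φ (0, x) (s, 0) :=
    ?_
  · obtain ⟨s, hs, hne⟩ := exists_param_forall_ne_zero (hΦ.of_le (by simp)) hC' hsurj
      (by rw [finrank_prod, finrank_euclideanSpace_fin, finrank_fin_fun]; omega) hO
    refine ⟨s, hs, fun x hx ↦ ?_⟩
    by_cases h0 : fderiv ℝ G x.1 x.2 = 0
    · obtain ⟨j, hj⟩ := Function.ne_iff.1 (hne x ⟨hx, h0⟩)
      refine ⟨j + 1, by omega, ?_⟩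
      rw [← paramDerivAlong_apply hΓ hA hG hU hP]
      exact hj
    · exact ⟨0, by omega, h0⟩
  · rintro ⟨y₀, v₀⟩ ⟨hx, h0⟩ -
    change fderiv ℝ G y₀ v₀ = 0 at h0
    have hθ1 : θ y₀ = 1 := hCθ _ hx
    have hv0 : v₀ ≠ 0 := hCv _ hx
    have hGw : fderiv ℝ G y₀ (A y₀ (fderiv ℝ G y₀)) ≠ 0 := hCG _ hx
    set w := A y₀ (fderiv ℝ G y₀) with hw
    have hvw : v₀ ∉ Submodule.span ℝ {w} := by
      intro h
      obtain ⟨r, rfl⟩ := Submodule.mem_span_singleton.1 h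
      rw [map_smul, smul_eq_mul, mul_eq_zero, or_iff_left hGw] at h0
      exact hv0 (by rw [h0, zero_smul])
    obtain ⟨α, hαv, hαw⟩ := exists_clm_eq_one_eq_zero hvw
    -- With this choice the diagonal entries are `-m! dG(w)`, which is nonzero by `hGw`.
    let β : EuclideanSpace ℝ (Fin n) →L[ℝ] ℝ := fderiv ℝ G y₀
    choose σ hσ using fun m ↦
      exists_sum_coordMonomial_eq_pow_mul (d := 2 * n + 1) α β y₀ m
    let a : EuclideanSpace ℝ (Fin n) → ℝ := fun y ↦ α (y - y₀)
    let b : EuclideanSpace ℝ (Fin n) → ℝ := fun y ↦ θ y * β (y - y₀)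
    have ha : ContDiff ℝ ∞ a := α.contDiff.comp (contDiff_id.sub contDiff_const)
    have hβ : ContDiff ℝ ∞ fun y ↦ β (y - y₀) :=
      β.contDiff.comp (contDiff_id.sub contDiff_const)
    have hb : ContDiff ℝ ∞ b := hθ.mul hβ
    have hPσ : ∀ m y, ∑ c, σ m c * P c y = a y ^ (m : ℕ) * b y := by
      intro m y
      have : ∑ c, σ m c * P c y = θ y * ∑ c, σ m c * coordMonomial c y := by
        rw [Finset.mul_sum]
        exact Finset.sum_congr rfl fun c _ ↦ by simp only [P]; ring
      rw [this, hσ]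
      simp only [a, b]
      ring
    have hlin : ∀ γ : EuclideanSpace ℝ (Fin n) →L[ℝ] ℝ,
        HasFDerivAt (fun y ↦ γ (y - y₀)) γ y₀ := fun γ ↦
      γ.hasFDerivAt.comp y₀ ((hasFDerivAt_id y₀).sub_const y₀)
    have hDa : fderiv ℝ a y₀ = α := (hlin α).fderiv
    have hDb : fderiv ℝ b y₀ = β := by
      have := ((differentiable_of_contDiff_infty hθ y₀).hasFDerivAt.mul (hlin β)).fderiv
      refine this.trans ?_
      simp [hθ1]
    have ha0 : a y₀ = 0 := by simp [a]
    have hb0 : b y₀ = 0 := by simp [b]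
    have hcomp : ∀ e j, (fderiv ℝ Φ (0, (y₀, v₀)) e) j =
        fderiv ℝ (paramDerivAlong Γ A G U P (j + 1)) (0, (y₀, v₀)) e := by
      intro e j
      have h1 : HasFDerivAt Φ _ _ := hasFDerivAt_pi.2 fun j : Fin (2 * n + 1) ↦
        (differentiable_of_contDiff_infty (hF (j + 1)) (0, (y₀, v₀))).hasFDerivAt
      rw [h1.fderiv]
      rfl
    refine LinearMap.surjective_of_triangular
      ((fderiv ℝ Φ (0, (y₀, v₀))).comp (.inl ℝ _ _)).toLinearMap σ ?_ ?_
    · intro m j hj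
      refine (hcomp _ j).trans ?_
      exact (vanishesToOrder_lieD_paramDerivAlong (z := (0, (y₀, v₀))) hΓ hA hG hU hP ha hb
        (hPσ m) ha0 hb0 (j + 1) 1 (by have : (j : ℕ) < m := hj; omega)).apply_eq_zero le_rfl
    · intro m
      have h2 := fderiv_paramDerivAlong_apply (z := (0, (y₀, v₀))) hΓ hA hG hU hP ha hb (hPσ m)
        hsymm ha0 hb0 (by simpa only [hDa] using hαw)
      refine ne_of_eq_of_ne ((hcomp _ m).trans h2) ?_
      simp only [hDa, hDb, hαv, one_pow, mul_one]
      exact neg_ne_zero.2 (mul_ne_zero (by positivity) hGw)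

/-! ### Joint continuity in the potential and the point, and openness of the generic condition. -/

section JointDerivatives

variable {T H : Type*} [TopologicalSpace T] [NormedAddCommGroup H] [NormedSpace ℝ H]

/-- The functions `u t` and their iterated directional derivatives of order at most `k` depend
continuously on the parameter `t` and the point of `K`. -/
def ContinuousDerivs (K : Set H) : ℕ → (T → H → ℝ) → Prop
  | 0, u => ContinuousOn (fun p : T × H ↦ u p.1 p.2) (Set.univ ×ˢ K)
  | k + 1, u => ContinuousOn (fun p : T × H ↦ u p.1 p.2) (Set.univ ×ˢ K) ∧
      ∀ e, ContinuousDerivs K k fun t z ↦ fderiv ℝ (u t) z e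

namespace ContinuousDerivs

variable {K : Set H} {k : ℕ} {u v : T → H → ℝ}

theorem continuousOn (h : ContinuousDerivs K k u) :
    ContinuousOn (fun p : T × H ↦ u p.1 p.2) (Set.univ ×ˢ K) := by
  cases k with
  | zero => exact h
  | succ k => exact h.1

theorem of_succ (h : ContinuousDerivs K (k + 1) u) : ContinuousDerivs K k u := by
  induction k generalizing u with
  | zero => exact h.1
  | succ k ih => exact ⟨h.1, fun e ↦ ih (h.2 e)⟩

theorem add (hu : ∀ t, ContDiff ℝ ∞ (u t)) (hv : ∀ t, ContDiff ℝ ∞ (v t))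
    (h : ContinuousDerivs K k u) (h' : ContinuousDerivs K k v) :
    ContinuousDerivs K k fun t z ↦ u t z + v t z := by
  induction k generalizing u v with
  | zero => exact ContinuousOn.add h h'
  | succ k ih =>
    refine ⟨h.1.add h'.1, fun e ↦ ?_⟩
    have : (fun t z ↦ fderiv ℝ (fun z ↦ u t z + v t z) z e) =
        fun t z ↦ fderiv ℝ (u t) z e + fderiv ℝ (v t) z e := by
      funext t z
      rw [fderiv_fun_add (differentiable_of_contDiff_infty (hu t) z)
        (differentiable_of_contDiff_infty (hv t) z)]
      rfl
    rw [this]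
    exact ih (fun t ↦ (contDiff_fderiv_infty (hu t)).clm_apply contDiff_const)
      (fun t ↦ (contDiff_fderiv_infty (hv t)).clm_apply contDiff_const) (h.2 e) (h'.2 e)

theorem mul (hu : ∀ t, ContDiff ℝ ∞ (u t)) (hv : ∀ t, ContDiff ℝ ∞ (v t))
    (h : ContinuousDerivs K k u) (h' : ContinuousDerivs K k v) :
    ContinuousDerivs K k fun t z ↦ u t z * v t z := by
  induction k generalizing u v with
  | zero => exact ContinuousOn.mul h h'
  | succ k ih =>
    refine ⟨h.1.mul h'.1, fun e ↦ ?_⟩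
    have : (fun t z ↦ fderiv ℝ (fun z ↦ u t z * v t z) z e) =
        fun t z ↦ u t z * fderiv ℝ (v t) z e + v t z * fderiv ℝ (u t) z e := by
      funext t z
      rw [fderiv_fun_mul (differentiable_of_contDiff_infty (hu t) z)
        (differentiable_of_contDiff_infty (hv t) z)]
      rfl
    rw [this]
    have hu' : ∀ t, ContDiff ℝ ∞ fun z ↦ fderiv ℝ (u t) z e := fun t ↦
      (contDiff_fderiv_infty (hu t)).clm_apply contDiff_const
    have hv' : ∀ t, ContDiff ℝ ∞ fun z ↦ fderiv ℝ (v t) z e := fun t ↦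
      (contDiff_fderiv_infty (hv t)).clm_apply contDiff_const
    exact add (fun t ↦ (hu t).mul (hv' t)) (fun t ↦ (hv t).mul (hu' t))
      (ih hu hv' h.of_succ (h'.2 e)) (ih hv hu' h'.of_succ (h.2 e))

theorem const {f : H → ℝ} (hf : ContDiff ℝ ∞ f) :
    ContinuousDerivs K k fun (_ : T) z ↦ f z := by
  induction k generalizing f with
  | zero => exact (hf.continuous.comp continuous_snd).continuousOn
  | succ k ih =>
    exact ⟨(hf.continuous.comp continuous_snd).continuousOn, fun e ↦
      ih ((contDiff_fderiv_infty hf).clm_apply contDiff_const)⟩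

theorem sum {κ : Type*} (s : Finset κ) {u : κ → T → H → ℝ}
    (hu : ∀ i t, ContDiff ℝ ∞ (u i t)) (h : ∀ i, ContinuousDerivs K k (u i)) :
    ContinuousDerivs K k fun t z ↦ ∑ i ∈ s, u i t z := by
  classical
  induction s using Finset.induction_on with
  | empty => simpa using const contDiff_const
  | insert i s hi ih =>
    simp only [Finset.sum_insert hi]
    exact add (hu i) (fun t ↦ ContDiff.sum fun j _ ↦ hu j t) (h i) ih

/-- The strong topology is phrased with `iteratedFDeriv`, while directional derivatives suit the
induction on Lie derivatives; this passes from one to the other. -/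
theorem of_iteratedFDeriv (hu : ∀ t, ContDiff ℝ ∞ (u t))
    (h : ∀ k, ContinuousOn (fun p : T × H ↦ iteratedFDeriv ℝ k (u p.1) p.2) (Set.univ ×ˢ K))
    (k : ℕ) : ContinuousDerivs K k u := by
  have h0 : ∀ u : T → H → ℝ,
      (∀ k, ContinuousOn (fun p : T × H ↦ iteratedFDeriv ℝ k (u p.1) p.2) (Set.univ ×ˢ K)) →
      ContinuousOn (fun p : T × H ↦ u p.1 p.2) (Set.univ ×ˢ K) := by
    intro u h
    have := (continuousMultilinearCurryFin0 ℝ H ℝ).continuous.comp_continuousOn (h 0)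
    exact this.congr fun p _ ↦ by simp
  induction k generalizing u with
  | zero => exact h0 u h
  | succ k ih =>
    refine ⟨h0 u h, fun e ↦ ih (fun t ↦ (contDiff_fderiv_infty (hu t)).clm_apply contDiff_const)
      fun j ↦ ?_⟩
    have heq : ∀ p : T × H, iteratedFDeriv ℝ j (fun z ↦ fderiv ℝ (u p.1) z e) p.2 =
        ContinuousLinearMap.compContinuousMultilinearMapL ℝ (fun _ : Fin j ↦ H) (H →L[ℝ] ℝ) ℝ
          (ContinuousLinearMap.apply ℝ ℝ e) (continuousMultilinearCurryRightEquiv' ℝ j H ℝ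
            (iteratedFDeriv ℝ (j + 1) (u p.1) p.2)) := by
      intro p
      rw [iteratedFDeriv_succ_eq_comp_right]
      simp only [Function.comp_apply, LinearIsometryEquiv.apply_symm_apply]
      exact (ContinuousLinearMap.apply ℝ ℝ e).iteratedFDeriv_comp_left
        ((contDiff_fderiv_infty (hu p.1)).contDiffAt (x := p.2))
        (i := j) (by exact_mod_cast le_top)
    simp only [heq]
    exact ((ContinuousLinearMap.compContinuousMultilinearMapL ℝ (fun _ : Fin j ↦ H)
      (H →L[ℝ] ℝ) ℝ (ContinuousLinearMap.apply ℝ ℝ e)).continuous.comp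
      (continuousMultilinearCurryRightEquiv' ℝ j H ℝ).continuous).comp_continuousOn (h (j + 1))

theorem comp_fst {E : Type*} [NormedAddCommGroup E] [NormedSpace ℝ E] {u : T → E → ℝ}
    {K : Set E} {C : Set (E × E)} (hu : ∀ t, ContDiff ℝ ∞ (u t))
    (h : ContinuousDerivs K k u) (hC : Set.MapsTo Prod.fst C K) :
    ContinuousDerivs C k fun t x ↦ u t x.1 := by
  have h0 : ∀ u : T → E → ℝ,
      ContinuousOn (fun p : T × E ↦ u p.1 p.2) (Set.univ ×ˢ K) →
      ContinuousOn (fun p : T × (E × E) ↦ u p.1 p.2.1) (Set.univ ×ˢ C) := by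
    intro u h
    exact h.comp (f := fun p : T × (E × E) ↦ (p.1, p.2.1)) (by fun_prop)
      fun p hp ↦ ⟨trivial, hC hp.2⟩
  induction k generalizing u with
  | zero => exact h0 u h
  | succ k ih =>
    refine ⟨h0 u h.1, fun e ↦ ?_⟩
    have : (fun t x ↦ fderiv ℝ (fun x : E × E ↦ u t x.1) x e) =
        fun t (x : E × E) ↦ fderiv ℝ (u t) x.1 e.1 := by
      funext t x
      have := ((differentiable_of_contDiff_infty (hu t) x.1).hasFDerivAt.comp x
        hasFDerivAt_fst).fderiv
      exact (congrArg (fun L : E × E →L[ℝ] ℝ ↦ L e) this)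
    rw [this]
    exact ih (fun t ↦ (contDiff_fderiv_infty (hu t)).clm_apply contDiff_const) (h.2 e.1)

theorem lieD [FiniteDimensional ℝ H] {X : T → H → H} (hX : ∀ t, ContDiff ℝ ∞ (X t))
    (hXc : ∀ ξ : H →L[ℝ] ℝ, ContinuousDerivs K k fun t z ↦ ξ (X t z))
    (hu : ∀ t, ContDiff ℝ ∞ (u t)) (h : ContinuousDerivs K (k + 1) u) :
    ContinuousDerivs K k fun t ↦ lieD (X t) (u t) := by
  let b := Module.finBasis ℝ H
  have heq : (fun t ↦ _root_.lieD (X t) (u t)) = fun t z ↦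
      ∑ i, LinearMap.toContinuousLinearMap (b.coord i) (X t z) * fderiv ℝ (u t) z (b i) := by
    funext t z
    rw [_root_.lieD]
    conv_lhs => rw [← b.sum_repr (X t z), map_sum]
    simp
  rw [heq]
  exact sum _ (fun i t ↦ ((ContinuousLinearMap.contDiff _).comp (hX t)).mul
    ((contDiff_fderiv_infty (hu t)).clm_apply contDiff_const))
    fun i ↦ mul (fun t ↦ (ContinuousLinearMap.contDiff _).comp (hX t))
      (fun t ↦ (contDiff_fderiv_infty (hu t)).clm_apply contDiff_const) (hXc _) (h.2 _)

end ContinuousDerivs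

end JointDerivatives

/-- The complement is the projection of a closed set along the compact factor `K`, hence closed. -/
theorem isOpen_forall_exists_ne_zero {T H : Type*} [TopologicalSpace T] [TopologicalSpace H]
    {K : Set H} (hK : IsCompact K) {N : ℕ}
    {f : ℕ → T → H → ℝ}
    (hf : ∀ j, ContinuousOn (fun p : T × H ↦ f j p.1 p.2) (Set.univ ×ˢ K)) :
    IsOpen {t | ∀ z ∈ K, ∃ j ≤ N, f j t z ≠ 0} := by
  have := isCompact_iff_compactSpace.1 hK
  have hcont : ∀ j, Continuous fun p : T × K ↦ f j p.1 p.2 := fun j ↦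
    (hf j).comp_continuous (f := fun p : T × K ↦ ((p.1, (p.2 : H)) : T × H)) (by fun_prop)
      fun p ↦ ⟨trivial, p.2.2⟩
  have hclosed : IsClosed {p : T × K | ∀ j ≤ N, f j p.1 p.2 = 0} := by
    simp only [Set.ofPred_forall]
    exact isClosed_iInter fun j ↦ isClosed_iInter fun _ ↦
      isClosed_eq (hcont j) continuous_const
  rw [← isClosed_compl_iff]
  convert isClosedMap_fst_of_compactSpace _ hclosed using 1
  ext t
  simp

/-- The condition on the potential that the derivatives of `G` along solutions do not all vanish
is open. -/
theorem isOpen_forall_exists_derivAlong_ne_zero {T E : Type*} [TopologicalSpace T]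
    [NormedAddCommGroup E] [NormedSpace ℝ E] [FiniteDimensional ℝ E]
    {Γ : E × E → E} {A : E → (E →L[ℝ] ℝ) →L[ℝ] E} {G : E → ℝ}
    (hΓ : ContDiff ℝ ∞ Γ) (hA : ContDiff ℝ ∞ A) (hG : ContDiff ℝ ∞ G) {W : T → E → ℝ}
    (hW : ∀ t, ContDiff ℝ ∞ (W t)) {C : Set (E × E)} (hC : IsCompact C)
    (hWC : ∀ k, ContinuousDerivs (Prod.fst '' C) k W) (N : ℕ) :
    IsOpen {t | ∀ x ∈ C, ∃ j ≤ N, derivAlong Γ A G (W t) j x ≠ 0} := by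
  have hWE : ∀ k, ContinuousDerivs C k fun t x ↦ W t x.1 := fun k ↦
    (hWC k).comp_fst hW (Set.mapsTo_image _ _)
  have hX : ∀ t, ContDiff ℝ ∞ (mechField Γ A (W t)) := fun t ↦ mechField_contDiff hΓ hA (hW t)
  let b := Module.finBasis ℝ E
  have hXc : ∀ k, ∀ ξ : E × E →L[ℝ] ℝ,
      ContinuousDerivs C k fun t z ↦ ξ (mechField Γ A (W t) z) := by
    intro k ξ
    have hdW : ∀ i t, ContDiff ℝ ∞ fun x : E × E ↦
        fderiv ℝ (fun x : E × E ↦ W t x.1) x (b i, 0) := fun i t ↦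
      (contDiff_fderiv_infty ((hW t).comp contDiff_fst)).clm_apply contDiff_const
    have hAb : ∀ i, ContDiff ℝ ∞ fun x : E × E ↦
        ξ (0, -A x.1 (LinearMap.toContinuousLinearMap (b.coord i))) := fun i ↦
      ξ.contDiff.comp (contDiff_const.prodMk
        ((hA.comp contDiff_fst).clm_apply contDiff_const).neg)
    -- In a basis, the field is a fixed smooth part plus the partial derivatives of `W t` times
    -- fixed smooth coefficients.
    have heq : (fun t z ↦ ξ (mechField Γ A (W t) z)) = fun t (x : E × E) ↦
        ξ (x.2, Γ x) + ∑ i, fderiv ℝ (fun x : E × E ↦ W t x.1) x (b i, 0) *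
          ξ (0, -A x.1 (LinearMap.toContinuousLinearMap (b.coord i))) := by
      funext t x
      have h1 : ∀ i, fderiv ℝ (fun x : E × E ↦ W t x.1) x (b i, 0) =
          fderiv ℝ (W t) x.1 (b i) := fun i ↦ congrArg (fun L : E × E →L[ℝ] ℝ ↦ L (b i, 0))
        ((differentiable_of_contDiff_infty (hW t) x.1).hasFDerivAt.comp x hasFDerivAt_fst).fderiv
      have h2 : fderiv ℝ (W t) x.1 = ∑ i, fderiv ℝ (W t) x.1 (b i) •
          LinearMap.toContinuousLinearMap (b.coord i) := by
        refine ContinuousLinearMap.ext fun y ↦ ?_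
        conv_lhs => rw [← b.sum_repr y, map_sum]
        simp [mul_comm]
      have h3 : mechField Γ A (W t) x = (x.2, Γ x) + ∑ i, fderiv ℝ (W t) x.1 (b i) •
          ((0, -A x.1 (LinearMap.toContinuousLinearMap (b.coord i))) : E × E) := by
        rw [mechField]
        conv_lhs => rw [h2]
        ext1
        · simp [Prod.fst_sum]
        · simp [Prod.snd_sum, sub_eq_add_neg]
      rw [h3, map_add, map_sum]
      simp only [h1, map_smul, smul_eq_mul]
    rw [heq]
    exact ContinuousDerivs.add (fun t ↦ ξ.contDiff.comp (contDiff_snd.prodMk hΓ))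
      (fun t ↦ ContDiff.sum fun i _ ↦ (hdW i t).mul (hAb i))
      (ContinuousDerivs.const (ξ.contDiff.comp (contDiff_snd.prodMk hΓ)))
      (ContinuousDerivs.sum _ (fun i t ↦ (hdW i t).mul (hAb i)) fun i ↦
        ContinuousDerivs.mul (hdW i) (fun _ ↦ hAb i) ((hWE (k + 1)).2 _)
          (ContinuousDerivs.const (hAb i)))
  have hder : ∀ j k, ContinuousDerivs C k fun t ↦ derivAlong Γ A G (W t) j := by
    intro j
    induction j with
    | zero => exact fun k ↦ ContinuousDerivs.const (contDiff_fderiv_fst_apply_snd hG)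
    | succ j ih =>
      intro k
      simp only [derivAlong, Function.iterate_succ_apply']
      exact ContinuousDerivs.lieD hX (hXc k)
        (fun t ↦ derivAlong_contDiff hΓ hA hG (hW t) j) (ih (k + 1))
  exact isOpen_forall_exists_ne_zero hC (f := fun j t ↦ derivAlong Γ A G (W t) j)
    fun j ↦ (hder j 0).continuousOn

/-! ### Cut-off functions. -/

section CutOff

variable {E F : Type*} [NormedAddCommGroup E] [NormedSpace ℝ E] [NormedAddCommGroup F]
  [NormedSpace ℝ F] {Ω K : Set E} {χ : E → ℝ} {f : E → F}

/-- Replaces data that are smooth only on the target of a chart by data smooth on the whole space,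
so that Lie derivatives can be taken without domains. -/
theorem contDiff_smul_of_tsupport_subset (hΩ : IsOpen Ω) (hχ : ContDiff ℝ ∞ χ)
    (hχΩ : tsupport χ ⊆ Ω) (hf : ContDiffOn ℝ ∞ f Ω) : ContDiff ℝ ∞ fun y ↦ χ y • f y := by
  rw [← contMDiff_iff_contDiff]
  refine contMDiff_of_tsupport fun x hx ↦ ContDiffAt.contMDiffAt ?_
  exact hχ.contDiffAt.smul
    (hf.contDiffAt (hΩ.mem_nhds (hχΩ (tsupport_smul_subset_left χ f hx))))

theorem exists_contDiff_cutOff [FiniteDimensional ℝ E] (hK : IsCompact K) (hΩ : IsOpen Ω)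
    (hKΩ : K ⊆ Ω) : ∃ χ : E → ℝ, ContDiff ℝ ∞ χ ∧ HasCompactSupport χ ∧ tsupport χ ⊆ Ω ∧
      ∀ᶠ y in 𝓝ˢ K, χ y = 1 := by
  obtain ⟨L, hL, hKL, hLΩ⟩ := exists_compact_between hK hΩ hKΩ
  obtain ⟨χ, h1, h0, -⟩ := exists_contMDiffMap_one_nhds_of_subset_interior (n := ⊤) 𝓘(ℝ, E)
    hK.isClosed hKL
  have hsub : tsupport χ ⊆ L := closure_minimal
    (fun y hy ↦ by_contra fun hyL ↦ hy (h0 y hyL)) hL.isClosed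
  exact ⟨χ, contMDiff_iff_contDiff.1 χ.contMDiff, hL.of_isClosed_subset (isClosed_tsupport _) hsub,
    hsub.trans hLΩ, h1⟩

theorem ContDiffOn.continuousOn_iteratedFDeriv_of_isOpen (hf : ContDiffOn ℝ ∞ f Ω)
    (hΩ : IsOpen Ω) (k : ℕ) : ContinuousOn (iteratedFDeriv ℝ k f) Ω :=
  (hf.continuousOn_iteratedFDerivWithin (m := k) (by exact_mod_cast le_top)
    hΩ.uniqueDiffOn).congr fun _ hy ↦ (iteratedFDerivWithin_of_isOpen k hΩ hy).symm

end CutOff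

/-! ### The strong topology in charts, and compactly supported perturbations. -/

section StrongTopology

variable {n : ℕ} {Q : Type*} [TopologicalSpace Q] [ChartedSpace (EuclideanSpace ℝ (Fin n)) Q]
  {φ : OpenPartialHomeomorph Q (EuclideanSpace ℝ (Fin n))}

theorem contDiffOn_comp_chart_symm [IsManifold (𝓡 n) ∞ Q] (hφ : φ ∈ IsManifold.maximalAtlas (𝓡 n) ∞ Q)
    (V : C^∞⟮𝓡 n, Q; 𝓘(ℝ, ℝ), ℝ⟯) : ContDiffOn ℝ ∞ (fun y ↦ V (φ.symm y)) φ.target := by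
  rw [← contMDiffOn_iff_contDiffOn]
  exact V.contMDiff.comp_contMDiffOn (contMDiffOn_symm_of_mem_maximalAtlas hφ)

theorem mem_nhds_strongBasicNhd_singleton (hφ : φ ∈ IsManifold.maximalAtlas (𝓡 n) ∞ Q)
    (V : C^∞⟮𝓡 n, Q; 𝓘(ℝ, ℝ), ℝ⟯) (r : ℕ) {K : Set Q} (hK : IsCompact K) (hKφ : K ⊆ φ.source)
    {ε : ℝ} (hε : 0 < ε) :
    strongBasicNhd V r (fun _ : Unit ↦ φ) (fun _ ↦ K) (fun _ ↦ ε) ∈ 𝓝 V := by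
  refine IsOpen.mem_nhds (TopologicalSpace.isOpen_generateFrom_of_mem
    ⟨V, r, Unit, _, _, _, fun _ ↦ hφ, locallyFinite_of_finite _, fun _ ↦ ⟨hK, hKφ⟩,
      fun _ ↦ hε, rfl⟩) ?_
  intro i x hx k hk
  simpa using hε

/-- The derivatives of a function in a chart, multiplied by a cut-off function, depend
continuously on the function for the strong topology. -/
theorem continuousDerivs_cutOff_comp_chart_symm [IsManifold (𝓡 n) ∞ Q] (hφ : φ ∈ IsManifold.maximalAtlas (𝓡 n) ∞ Q)
    {χ : EuclideanSpace ℝ (Fin n) → ℝ} (hχ : ContDiff ℝ ∞ χ) (hχφ : tsupport χ ⊆ φ.target)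
    {K : Set (EuclideanSpace ℝ (Fin n))} (hK : IsCompact K) (hKφ : K ⊆ φ.target)
    (hχK : ∀ᶠ y in 𝓝ˢ K, χ y = 1) (k : ℕ) :
    ContinuousDerivs K k fun (V : C^∞⟮𝓡 n, Q; 𝓘(ℝ, ℝ), ℝ⟯) y ↦ χ y * V (φ.symm y) := by
  have hsm : ∀ V : C^∞⟮𝓡 n, Q; 𝓘(ℝ, ℝ), ℝ⟯, ContDiff ℝ ∞ fun y ↦ χ y * V (φ.symm y) :=
    fun V ↦ contDiff_smul_of_tsupport_subset φ.open_target hχ hχφ (contDiffOn_comp_chart_symm hφ V)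
  have heq : ∀ (V : C^∞⟮𝓡 n, Q; 𝓘(ℝ, ℝ), ℝ⟯) (k : ℕ), ∀ y ∈ K,
      iteratedFDeriv ℝ k (fun y ↦ χ y * V (φ.symm y)) y =
        iteratedFDeriv ℝ k (fun y ↦ V (φ.symm y)) y := by
    intro V k y hy
    refine (Filter.EventuallyEq.iteratedFDeriv ℝ ?_ k).eq_of_nhds
    filter_upwards [hχK.filter_mono (nhds_le_nhdsSet hy)] with z hz
    rw [hz, one_mul]
  refine ContinuousDerivs.of_iteratedFDeriv hsm (fun k ↦ ?_) k
  rintro ⟨V₀, y₀⟩ ⟨-, hy₀⟩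
  rw [ContinuousWithinAt, Metric.tendsto_nhds]
  intro ε hε
  have hS : IsCompact (φ.symm '' K) := hK.image_of_continuousOn (φ.symm.continuousOn.mono hKφ)
  have h1 := mem_nhds_strongBasicNhd_singleton hφ V₀ k hS
    (by rintro _ ⟨y, hy, rfl⟩; exact φ.map_target (hKφ hy)) (half_pos hε)
  -- The strong neighbourhood controls the change of function uniformly on `K`; this controls the
  -- change of point for the fixed function `V₀`.
  have h2 : ∀ᶠ y in 𝓝 y₀, dist (iteratedFDeriv ℝ k (fun y ↦ χ y * V₀ (φ.symm y)) y)
      (iteratedFDeriv ℝ k (fun y ↦ χ y * V₀ (φ.symm y)) y₀) < ε / 2 :=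
    Metric.tendsto_nhds.1 ((hsm V₀).continuous_iteratedFDeriv (m := k)
      (by exact_mod_cast le_top)).continuousAt _ (half_pos hε)
  have h3 := (Filter.Eventually.prod_nhds h1 h2).filter_mono
    (nhdsWithin_le_nhds (s := Set.univ ×ˢ K))
  filter_upwards [h3, self_mem_nhdsWithin] with p hp hpK
  refine (dist_triangle _ (iteratedFDeriv ℝ k (fun y ↦ χ y * V₀ (φ.symm y)) p.2) _).trans_lt ?_
  have h4 := hp.1 () (φ.symm p.2) (Set.mem_image_of_mem _ hpK.2) k le_rfl
  rw [φ.right_inv (hKφ hpK.2), ← heq _ _ _ hpK.2, ← heq _ _ _ hpK.2, ← dist_eq_norm] at h4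
  linarith [hp.2]

/-- A function with compact support in the target of a chart, transported to the manifold. -/
theorem exists_contMDiffMap_comp_chart_symm_eq [T2Space Q] [IsManifold (𝓡 n) ∞ Q]
    (hφ : φ ∈ IsManifold.maximalAtlas (𝓡 n) ∞ Q)
    {f : EuclideanSpace ℝ (Fin n) → ℝ} (hf : ContDiff ℝ ∞ f) {L : Set (EuclideanSpace ℝ (Fin n))}
    (hL : IsCompact L) (hLφ : L ⊆ φ.target) (hfL : tsupport f ⊆ L) :
    ∃ P : C^∞⟮𝓡 n, Q; 𝓘(ℝ, ℝ), ℝ⟯, (∀ y ∈ φ.target, P (φ.symm y) = f y) ∧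
      ∀ q ∉ φ.symm '' L, P q = 0 := by
  have hS : IsCompact (φ.symm '' L) := hL.image_of_continuousOn (φ.symm.continuousOn.mono hLφ)
  have hzero : ∀ q ∉ φ.symm '' L, φ.source.indicator (fun q ↦ f (φ q)) q = 0 := by
    intro q hq
    rw [Set.indicator_apply_eq_zero]
    intro hqφ
    by_contra h
    exact hq ⟨φ q, hfL (subset_tsupport _ h), φ.left_inv hqφ⟩
  refine ⟨⟨φ.source.indicator fun q ↦ f (φ q), ?_⟩, fun y hy ↦ ?_, hzero⟩
  · refine contMDiff_of_tsupport fun q hq ↦ ?_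
    have hqφ : q ∈ φ.source := by
      obtain ⟨y, hy, rfl⟩ := closure_minimal
        (fun q (hq : _ ≠ _) ↦ by_contra fun h ↦ hq (hzero q h)) hS.isClosed hq
      exact φ.map_target (hLφ hy)
    refine (hf.contMDiff.contMDiffAt.comp q
      (contMDiffAt_of_mem_maximalAtlas hφ hqφ)).congr_of_eventuallyEq ?_
    filter_upwards [φ.open_source.mem_nhds hqφ] with x hx
    exact Set.indicator_of_mem hx _
  · change φ.source.indicator (fun q ↦ f (φ q)) (φ.symm y) = f y
    rw [Set.indicator_of_mem (φ.map_target hy), φ.right_inv hy]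

theorem add_sum_smul_apply {ι : Type*} [Fintype ι] (V : C^∞⟮𝓡 n, Q; 𝓘(ℝ, ℝ), ℝ⟯)
    (P : ι → C^∞⟮𝓡 n, Q; 𝓘(ℝ, ℝ), ℝ⟯) (s : ι → ℝ) (q : Q) :
    (V + ∑ c, s c • P c) q = V q + ∑ c, s c * P c q := by
  have : ∀ t : Finset ι, (∑ c ∈ t, s c • P c : C^∞⟮𝓡 n, Q; 𝓘(ℝ, ℝ), ℝ⟯) q =
      ∑ c ∈ t, s c * P c q := by
    classical
    intro t
    induction t using Finset.induction_on with
    | empty => rfl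
    | insert c t hc ih =>
      rw [Finset.sum_insert hc, Finset.sum_insert hc, ← ih]
      rfl
  exact congrArg (V q + ·) (this _)

/-- Finite-dimensional families of compactly supported perturbations are continuous for the
strong topology. -/
theorem continuous_add_sum_smul_strongTopology [IsManifold (𝓡 n) ∞ Q] {ι : Type*} [Fintype ι]
    (V : C^∞⟮𝓡 n, Q; 𝓘(ℝ, ℝ), ℝ⟯) (P : ι → C^∞⟮𝓡 n, Q; 𝓘(ℝ, ℝ), ℝ⟯) {S : Set Q}
    (hS : IsCompact S) (hP : ∀ c, ∀ q ∉ S, P c q = 0) :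
    Continuous fun s : ι → ℝ ↦ V + ∑ c, s c • P c := by
  refine continuous_generateFrom_iff.2 ?_
  rintro _ ⟨f, r, κ, φ, K, ε, hφ, hfin, hK, hε, rfl⟩
  rw [isOpen_iff_mem_nhds]
  intro s₀ hs₀
  have hval := add_sum_smul_apply V P
  -- By local finiteness only finitely many conditions involve `s`; in the other charts the
  -- perturbation is zero.
  have hmeet : {i | ((φ i).source ∩ S).Nonempty}.Finite := hfin.finite_nonempty_inter_compact hS
  have hev : ∀ᶠ s in 𝓝 s₀, ∀ i ∈ {i | ((φ i).source ∩ S).Nonempty}, ∀ x ∈ K i, ∀ k ≤ r,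
      ‖iteratedFDeriv ℝ k (fun y ↦ (V + ∑ c, s c • P c) ((φ i).symm y)) (φ i x) -
        iteratedFDeriv ℝ k (fun y ↦ f ((φ i).symm y)) (φ i x)‖ < ε i := by
    rw [Filter.eventually_all_finite hmeet]
    intro i _
    have hder : ∀ k, ∀ s : ι → ℝ, ∀ x ∈ (φ i).source,
        iteratedFDeriv ℝ k (fun y ↦ (V + ∑ c, s c • P c) ((φ i).symm y)) (φ i x) =
        iteratedFDeriv ℝ k (fun y ↦ V ((φ i).symm y)) (φ i x) +
          ∑ c, s c • iteratedFDeriv ℝ k (fun y ↦ P c ((φ i).symm y)) (φ i x) := by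
      intro k s x hx
      have hat : ∀ W : C^∞⟮𝓡 n, Q; 𝓘(ℝ, ℝ), ℝ⟯,
          ContDiffAt ℝ k (fun y ↦ W ((φ i).symm y)) (φ i x) := fun W ↦
        ((contDiffOn_comp_chart_symm (hφ i) W).contDiffAt
          ((φ i).open_target.mem_nhds ((φ i).map_source hx))).of_le (by exact_mod_cast le_top)
      have h1 : (fun y ↦ (V + ∑ c, s c • P c) ((φ i).symm y)) =
          (fun y ↦ V ((φ i).symm y)) +
            ∑ c, (s c • fun y ↦ P c ((φ i).symm y)) := by
        funext y
        simp [hval]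
      have h2 : ∀ c, ContDiffAt ℝ k (s c • fun y ↦ P c ((φ i).symm y)) (φ i x) := fun c ↦
        contDiffAt_const.smul (hat (P c))
      have h3 : ∀ t : Finset ι,
          ContDiffAt ℝ k (∑ c ∈ t, (s c • fun y ↦ P c ((φ i).symm y))) (φ i x) ∧
          iteratedFDeriv ℝ k (∑ c ∈ t, (s c • fun y ↦ P c ((φ i).symm y))) (φ i x) =
            ∑ c ∈ t, s c • iteratedFDeriv ℝ k (fun y ↦ P c ((φ i).symm y)) (φ i x) := by
        classical
        intro t
        induction t using Finset.induction_on with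
        | empty => exact ⟨contDiffAt_const, congrFun iteratedFDeriv_fun_zero _⟩
        | insert c t hc ih =>
          rw [Finset.sum_insert hc, Finset.sum_insert hc, ← ih.2]
          refine ⟨(h2 c).add ih.1, (iteratedFDeriv_add_apply (h2 c) ih.1).trans ?_⟩
          rw [iteratedFDeriv_const_smul_apply (hat (P c))]
      rw [h1, ← (h3 Finset.univ).2]
      exact iteratedFDeriv_add_apply (hat V) (h3 Finset.univ).1
    have hcont : ∀ k, ∀ W : C^∞⟮𝓡 n, Q; 𝓘(ℝ, ℝ), ℝ⟯,
        ContinuousOn (fun x ↦ iteratedFDeriv ℝ k (fun y ↦ W ((φ i).symm y)) (φ i x))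
          (φ i).source := fun k W ↦
      ((contDiffOn_comp_chart_symm (hφ i) W).continuousOn_iteratedFDeriv_of_isOpen
        (φ i).open_target k).comp (φ i).continuousOn (φ i).mapsTo
    have hall : ∀ k ∈ Finset.range (r + 1), ∀ᶠ s in 𝓝 s₀, ∀ x ∈ K i,
        ‖iteratedFDeriv ℝ k (fun y ↦ (V + ∑ c, s c • P c) ((φ i).symm y)) (φ i x) -
        iteratedFDeriv ℝ k (fun y ↦ f ((φ i).symm y)) (φ i x)‖ < ε i := by
      intro k hk
      refine (hK i).1.eventually_forall_of_forall_eventually fun x hx ↦ ?_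
      have hxφ := (hK i).2 hx
      have hnear := (φ i).open_source.mem_nhds hxφ
      have hc : ContinuousAt (fun p : (ι → ℝ) × Q ↦
          ‖iteratedFDeriv ℝ k (fun y ↦ V ((φ i).symm y)) (φ i p.2) +
          ∑ c, p.1 c • iteratedFDeriv ℝ k (fun y ↦ P c ((φ i).symm y)) (φ i p.2) -
          iteratedFDeriv ℝ k (fun y ↦ f ((φ i).symm y)) (φ i p.2)‖) (s₀, x) := by
        have hc' : ∀ W : C^∞⟮𝓡 n, Q; 𝓘(ℝ, ℝ), ℝ⟯, ContinuousAt (fun p : (ι → ℝ) × Q ↦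
            iteratedFDeriv ℝ k (fun y ↦ W ((φ i).symm y)) (φ i p.2)) (s₀, x) := fun W ↦
          ((hcont k W).continuousAt hnear).comp (f := fun p : (ι → ℝ) × Q ↦ p.2)
            (x := (s₀, x)) continuousAt_snd
        refine (((hc' V).add ?_).sub (hc' f)).norm
        refine tendsto_finsetSum _ fun c _ ↦ ?_
        exact Filter.Tendsto.smul (((continuous_apply c).comp continuous_fst).continuousAt)
          (hc' (P c))
      have hlt := hs₀ i x hx k (Finset.mem_range_succ_iff.1 hk)
      rw [hder k s₀ x hxφ] at hlt
      filter_upwards [hc.eventually_lt_const hlt,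
        continuousAt_snd.preimage_mem_nhds hnear] with p hp hpφ
      rw [hder k p.1 p.2 hpφ]
      exact hp
    filter_upwards [(Filter.eventually_all_finset _).2 hall] with s hs x hx k hk
    exact hs k (Finset.mem_range_succ_iff.2 hk) x hx
  filter_upwards [hev] with s hs i x hx k hk
  by_cases hi : ((φ i).source ∩ S).Nonempty
  · exact hs i hi x hx k hk
  · have hfar : ∀ s : ι → ℝ, (fun y ↦ (V + ∑ c, s c • P c) ((φ i).symm y)) =ᶠ[𝓝 (φ i x)]
        fun y ↦ V ((φ i).symm y) := by
      intro s
      filter_upwards [(φ i).open_target.mem_nhds ((φ i).map_source ((hK i).2 hx))] with y hy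
      rw [hval, Finset.sum_eq_zero, add_zero]
      intro c _
      rw [hP c, mul_zero]
      exact fun h ↦ hi ⟨_, (φ i).map_target hy, h⟩
    have h0 := hs₀ i x hx k hk
    rw [((hfar s₀).iteratedFDeriv ℝ k).eq_of_nhds] at h0
    rwa [((hfar s).iteratedFDeriv ℝ k).eq_of_nhds]

end StrongTopology

/-! ### The metric in coordinates. -/

section ChartMetric

variable {n : ℕ} {Q : Type*} [TopologicalSpace Q] [ChartedSpace (EuclideanSpace ℝ (Fin n)) Q]
  [IsManifold (𝓡 n) ∞ Q]
  (g : Bundle.ContMDiffRiemannianMetric (𝓡 n) ∞ (EuclideanSpace ℝ (Fin n))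
    (fun q : Q ↦ TangentSpace (𝓡 n) q))
  {φ : OpenPartialHomeomorph Q (EuclideanSpace ℝ (Fin n))}

/-- The Riemannian metric in the coordinates of a chart. -/
noncomputable def chartMetric (φ : OpenPartialHomeomorph Q (EuclideanSpace ℝ (Fin n)))
    (y : EuclideanSpace ℝ (Fin n)) :
    EuclideanSpace ℝ (Fin n) →L[ℝ] EuclideanSpace ℝ (Fin n) →L[ℝ] ℝ :=
  let D : EuclideanSpace ℝ (Fin n) →L[ℝ] EuclideanSpace ℝ (Fin n) :=
    mfderiv (𝓡 n) (𝓡 n) φ.symm y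
  let b : EuclideanSpace ℝ (Fin n) →L[ℝ] EuclideanSpace ℝ (Fin n) →L[ℝ] ℝ :=
    g.inner (φ.symm y)
  b.bilinearComp D D

theorem chartMetric_symm (y v w : EuclideanSpace ℝ (Fin n)) :
    chartMetric g φ y v w = chartMetric g φ y w v :=
  g.symm _ _ _

theorem localLagrangian_mechanicalLagrangian (V : Q → ℝ) (y v : EuclideanSpace ℝ (Fin n)) :
    localLagrangian (mechanicalLagrangian g V) φ y v =
      1 / 2 * chartMetric g φ y v v - V (φ.symm y) :=
  rfl

omit [IsManifold (𝓡 n) ∞ Q] in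
theorem mfderiv_chart_symm_injective (hφ : φ ∈ IsManifold.maximalAtlas (𝓡 n) ∞ Q)
    {y : EuclideanSpace ℝ (Fin n)} (hy : y ∈ φ.target) :
    Function.Injective (mfderiv (𝓡 n) (𝓡 n) φ.symm y) := by
  have h1 : MDifferentiableAt (𝓡 n) (𝓡 n) φ.symm y :=
    (contMDiffAt_symm_of_mem_maximalAtlas hφ hy).mdifferentiableAt (by simp)
  have h2 : MDifferentiableAt (𝓡 n) (𝓡 n) φ (φ.symm y) :=
    (contMDiffAt_of_mem_maximalAtlas hφ (φ.map_target hy)).mdifferentiableAt (by simp)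
  have h3 : mfderiv (𝓡 n) (𝓡 n) (φ ∘ φ.symm) y = ContinuousLinearMap.id ℝ _ := by
    rw [Filter.EventuallyEq.mfderiv_eq (f := id), mfderiv_id]
    filter_upwards [φ.open_target.mem_nhds hy] with z hz
    exact φ.right_inv hz
  rw [mfderiv_comp y h2 h1] at h3
  exact Function.LeftInverse.injective fun v ↦ DFunLike.congr_fun h3 v

theorem chartMetric_pos (hφ : φ ∈ IsManifold.maximalAtlas (𝓡 n) ∞ Q)
    {y : EuclideanSpace ℝ (Fin n)} (hy : y ∈ φ.target) {v : EuclideanSpace ℝ (Fin n)}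
    (hv : v ≠ 0) : 0 < chartMetric g φ y v v := by
  refine g.pos _ _ fun h ↦ hv (mfderiv_chart_symm_injective hφ hy ?_)
  exact h.trans (map_zero (mfderiv (𝓡 n) (𝓡 n) φ.symm y)).symm

/-- The coefficients are the smooth metric evaluated on the images of constant fields under the
tangent map of `φ.symm`, which are smooth. -/
theorem chartMetric_contDiffOn (hφ : φ ∈ IsManifold.maximalAtlas (𝓡 n) ∞ Q) :
    ContDiffOn ℝ ∞ (chartMetric g φ) φ.target := by
  have hone : IsManifold (𝓡 n) 1 Q := IsManifold.of_le (n := ∞) (by simp)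
  have hsymm := contMDiffOn_symm_of_mem_maximalAtlas hφ
  have hsec : ∀ v : EuclideanSpace ℝ (Fin n), ContMDiffOn (𝓡 n) (𝓡 n).tangent ∞
      (fun y ↦ (⟨φ.symm y, mfderiv (𝓡 n) (𝓡 n) φ.symm y v⟩ : TangentBundle (𝓡 n) Q))
      φ.target := by
    intro v
    have h1 := hsymm.contMDiffOn_tangentMapWithin (m := ∞) (by simp)
      φ.open_target.uniqueMDiffOn
    have h2 : ContMDiffOn (𝓡 n) (𝓡 n).tangent ∞
        (fun y ↦ (⟨y, v⟩ : TangentBundle (𝓡 n) (EuclideanSpace ℝ (Fin n)))) φ.target :=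
      contMDiffOn_vectorSpace_iff_contDiffOn.2 contDiffOn_const
    refine (h1.comp h2 fun y hy ↦ hy).congr fun y hy ↦ ?_
    simp only [Function.comp_apply, tangentMapWithin]
    rw [mfderivWithin_of_isOpen φ.open_target hy]
  rw [contDiffOn_clm_apply]
  intro v
  rw [contDiffOn_clm_apply]
  intro w
  rw [← contMDiffOn_iff_contDiffOn]
  have h3 := ContMDiffOn.clm_bundle_apply₂ (F₁ := EuclideanSpace ℝ (Fin n))
    (F₂ := EuclideanSpace ℝ (Fin n)) (F₃ := ℝ) (E₃ := Bundle.Trivial Q ℝ)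
    (g.contMDiff.comp_contMDiffOn hsymm) (hsec v) (hsec w)
  intro y hy
  exact (Bundle.contMDiffWithinAt_totalSpace.1 (h3 y hy)).2

end ChartMetric

/-! ### The Euler–Lagrange equations solved for the acceleration. -/

section EulerLagrange

variable {E : Type*} [NormedAddCommGroup E] [NormedSpace ℝ E]

/-- The part of the acceleration of the Euler–Lagrange equations of `½ B(v, v) - U` that does not
depend on the potential; `A` stands for the inverse of the metric `B`. -/
noncomputable def geodesicAccel (B : E → E →L[ℝ] E →L[ℝ] ℝ) (A : E → (E →L[ℝ] ℝ) →L[ℝ] E)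
    (x : E × E) : E :=
  A x.1 (fderiv ℝ (fun y ↦ 1 / 2 * B y x.2 x.2) x.1 - fderiv ℝ B x.1 x.2 x.2)

theorem geodesicAccel_contDiff {B : E → E →L[ℝ] E →L[ℝ] ℝ} {A : E → (E →L[ℝ] ℝ) →L[ℝ] E}
    (hB : ContDiff ℝ ∞ B) (hA : ContDiff ℝ ∞ A) : ContDiff ℝ ∞ (geodesicAccel B A) := by
  refine (hA.comp contDiff_fst).clm_apply (ContDiff.sub ?_ ?_)
  · refine ContDiff.fderiv (m := ∞) (n := ∞) (f := fun (x : E × E) y ↦ 1 / 2 * B y x.2 x.2) ?_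
      contDiff_fst (by simp)
    have h2 : ContDiff ℝ ∞ fun p : (E × E) × E ↦ p.1.2 := contDiff_snd.comp contDiff_fst
    exact contDiff_const.mul (((hB.comp contDiff_snd).clm_apply h2).clm_apply h2)
  · exact (((contDiff_fderiv_infty hB).comp contDiff_fst).clm_apply contDiff_snd).clm_apply
      contDiff_snd

theorem fderiv_kinetic {b : E →L[ℝ] E →L[ℝ] ℝ} (hb : ∀ v w, b v w = b w v) (u : ℝ) (v : E) :
    fderiv ℝ (fun v ↦ 1 / 2 * b v v - u) v = b v := by
  have h1 : HasFDerivAt (fun v ↦ b v v) _ v := b.hasFDerivAt.clm_apply (hasFDerivAt_id v)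
  refine ((h1.const_mul (1 / 2)).sub_const u).fderiv.trans ?_
  ext w
  simp [hb w v]
  ring

theorem ContDiffAt.hasDerivAt_deriv {c : ℝ → E} {t : ℝ} (hc : ContDiffAt ℝ 2 c t) :
    HasDerivAt (deriv c) (deriv (deriv c) t) t := by
  refine DifferentiableAt.hasDerivAt ?_
  have h1 : ContDiffAt ℝ 1 (fderiv ℝ c) t := hc.fderiv_right (by norm_num)
  have h2 : deriv c = fun s ↦ fderiv ℝ c s 1 := by
    ext s; simp
  rw [h2]
  exact (h1.differentiableAt one_ne_zero).clm_apply (differentiableAt_const _)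

/-- The Euler–Lagrange equations of `½ B(v, v) - U`, solved for the acceleration. -/
theorem hasDerivAt_deriv_of_eulerLagrange {B B₀ : E → E →L[ℝ] E →L[ℝ] ℝ}
    {A : E → (E →L[ℝ] ℝ) →L[ℝ] E} {U U₀ : E → ℝ} {c : ℝ → E} {t : ℝ}
    (hB : ContDiff ℝ ∞ B) (hU : ContDiff ℝ ∞ U) (hc : ContDiffAt ℝ 2 c t)
    (hB₀ : B₀ =ᶠ[𝓝 (c t)] B) (hU₀ : U₀ =ᶠ[𝓝 (c t)] U)
    (hsymm : ∀ᶠ y in 𝓝 (c t), ∀ v w, B₀ y v w = B₀ y w v)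
    (hAB : ∀ v, A (c t) (B (c t) v) = v)
    (hEL : HasDerivAt
      (fun s ↦ fderiv ℝ (fun v ↦ 1 / 2 * B₀ (c s) v v - U₀ (c s)) (deriv c s))
      (fderiv ℝ (fun y ↦ 1 / 2 * B₀ y (deriv c t) (deriv c t) - U₀ y) (c t)) t) :
    HasDerivAt (deriv c)
      (geodesicAccel B A (c t, deriv c t) - A (c t) (fderiv ℝ U (c t))) t := by
  have hdc := hc.hasDerivAt_deriv
  have hc1 : HasDerivAt c (deriv c t) t := (hc.differentiableAt (by norm_num)).hasDerivAt
  set v := deriv c t with hv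
  -- The momentum is `B(c)(c')`. The local data `B₀`, `U₀` and the globally smooth `B`, `U` agree
  -- near the point, so their derivatives there agree too.
  have hmom : (fun s ↦ fderiv ℝ (fun v ↦ 1 / 2 * B₀ (c s) v v - U₀ (c s)) (deriv c s)) =ᶠ[𝓝 t]
      fun s ↦ B (c s) (deriv c s) := by
    filter_upwards [hc1.continuousAt.eventually (hsymm.and hB₀)] with s hs
    rw [fderiv_kinetic hs.1, hs.2]
  have hBd := (differentiable_of_contDiff_infty hB (c t)).hasFDerivAt
  have h1 : HasDerivAt (fun s ↦ B (c s) (deriv c s))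
      (fderiv ℝ B (c t) v v + B (c t) (deriv (deriv c) t)) t :=
    (hBd.comp_hasDerivAt t hc1).clm_apply hdc
  have h2 := h1.unique (hEL.congr_of_eventuallyEq hmom.symm)
  have h3 : fderiv ℝ (fun y ↦ 1 / 2 * B₀ y v v - U₀ y) (c t) =
      fderiv ℝ (fun y ↦ 1 / 2 * B y v v) (c t) - fderiv ℝ U (c t) := by
    have h4 : (fun y ↦ 1 / 2 * B₀ y v v - U₀ y) =ᶠ[𝓝 (c t)] fun y ↦ 1 / 2 * B y v v - U y := by
      filter_upwards [hB₀, hU₀] with y hy hy'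
      rw [hy, hy']
    rw [h4.fderiv_eq, fderiv_fun_sub _ (differentiable_of_contDiff_infty hU _)]
    exact ((hBd.differentiableAt.clm_apply (differentiableAt_const _)).clm_apply
      (differentiableAt_const _)).const_mul _
  have h5 : B (c t) (deriv (deriv c) t) = fderiv ℝ (fun y ↦ 1 / 2 * B y v v) (c t) -
      fderiv ℝ B (c t) v v - fderiv ℝ U (c t) := by
    rw [h3] at h2
    rw [← sub_eq_iff_eq_add'.2 h2.symm]
    abel
  have h6 : deriv (deriv c) t = geodesicAccel B A (c t, v) - A (c t) (fderiv ℝ U (c t)) := by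
    rw [← hAB (deriv (deriv c) t), h5, map_sub]
    rfl
  rwa [h6] at hdc

/-- Along a solution on which `G` is constant, all the derivatives of `G` along solutions
vanish. -/
theorem eventually_derivAlong_eq_zero {Γ : E × E → E} {A : E → (E →L[ℝ] ℝ) →L[ℝ] E}
    {G U : E → ℝ} {c : ℝ → E} {t : ℝ} {r : ℝ}
    (hΓ : ContDiff ℝ ∞ Γ) (hA : ContDiff ℝ ∞ A) (hG : ContDiff ℝ ∞ G) (hU : ContDiff ℝ ∞ U)
    (hc : ∀ᶠ s in 𝓝 t, HasDerivAt c (deriv c s) s)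
    (hc' : ∀ᶠ s in 𝓝 t,
      HasDerivAt (deriv c) (Γ (c s, deriv c s) - A (c s) (fderiv ℝ U (c s))) s)
    (hGc : ∀ᶠ s in 𝓝 t, G (c s) = r) (j : ℕ) :
    ∀ᶠ s in 𝓝 t, derivAlong Γ A G U j (c s, deriv c s) = 0 := by
  have hzero : ∀ (f : ℝ → ℝ) (r : ℝ), (∀ᶠ s in 𝓝 t, f s = r) →
      ∀ᶠ s in 𝓝 t, ∀ d, HasDerivAt f d s → d = 0 := by
    intro f r hf
    filter_upwards [hf.eventually_nhds] with s hs d hd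
    exact hd.unique ((hasDerivAt_const s r).congr_of_eventuallyEq hs)
  induction j with
  | zero =>
    filter_upwards [hzero _ r hGc, hc] with s hs hcs
    exact hs _ ((differentiable_of_contDiff_infty hG (c s)).hasFDerivAt.comp_hasDerivAt s hcs)
  | succ j ih =>
    filter_upwards [hzero _ 0 ih, hc, hc'] with s hs hcs hcs'
    rw [derivAlong, Function.iterate_succ_apply', ← derivAlong]
    exact hs _ ((differentiable_of_contDiff_infty (derivAlong_contDiff hΓ hA hG hU j)
      (c s, deriv c s)).hasFDerivAt.comp_hasDerivAt s (hcs.prodMk hcs'))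

end EulerLagrange

/-! ### The inverse metric in coordinates. -/

section InverseMetric

variable {n : ℕ} {Q : Type*} [TopologicalSpace Q] [ChartedSpace (EuclideanSpace ℝ (Fin n)) Q]
  [IsManifold (𝓡 n) ∞ Q]
  (g : Bundle.ContMDiffRiemannianMetric (𝓡 n) ∞ (EuclideanSpace ℝ (Fin n))
    (fun q : Q ↦ TangentSpace (𝓡 n) q))
  {φ : OpenPartialHomeomorph Q (EuclideanSpace ℝ (Fin n))}

theorem exists_continuousLinearEquiv_eq_chartMetric
    (hφ : φ ∈ IsManifold.maximalAtlas (𝓡 n) ∞ Q) {y : EuclideanSpace ℝ (Fin n)}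
    (hy : y ∈ φ.target) :
    ∃ e : EuclideanSpace ℝ (Fin n) ≃L[ℝ] (EuclideanSpace ℝ (Fin n) →L[ℝ] ℝ),
      (e : EuclideanSpace ℝ (Fin n) →L[ℝ] (EuclideanSpace ℝ (Fin n) →L[ℝ] ℝ)) =
        chartMetric g φ y := by
  have hinj : Function.Injective (chartMetric g φ y).toLinearMap := by
    refine LinearMap.ker_eq_bot.1 (LinearMap.ker_eq_bot'.2 fun v hv ↦ ?_)
    by_contra h
    refine (chartMetric_pos g hφ hy h).ne' ?_
    exact DFunLike.congr_fun hv v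
  have hdim : Module.finrank ℝ (EuclideanSpace ℝ (Fin n)) =
      Module.finrank ℝ (EuclideanSpace ℝ (Fin n) →L[ℝ] ℝ) := by
    rw [← (LinearMap.toContinuousLinearMap (𝕜 := ℝ) (E := EuclideanSpace ℝ (Fin n))
      (F' := ℝ)).finrank_eq]
    exact (Subspace.dual_finrank_eq (K := ℝ) (V := EuclideanSpace ℝ (Fin n))).symm
  refine ⟨(LinearMap.linearEquivOfInjective _ hinj hdim).toContinuousLinearEquiv, ?_⟩
  ext v w
  rfl

/-- The inverse of the Riemannian metric in the coordinates of a chart. -/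
noncomputable def chartInverseMetric
    (φ : OpenPartialHomeomorph Q (EuclideanSpace ℝ (Fin n))) (y : EuclideanSpace ℝ (Fin n)) :
    (EuclideanSpace ℝ (Fin n) →L[ℝ] ℝ) →L[ℝ] EuclideanSpace ℝ (Fin n) :=
  ContinuousLinearMap.inverse (chartMetric g φ y)

theorem chartInverseMetric_chartMetric (hφ : φ ∈ IsManifold.maximalAtlas (𝓡 n) ∞ Q)
    {y : EuclideanSpace ℝ (Fin n)} (hy : y ∈ φ.target) (v : EuclideanSpace ℝ (Fin n)) :
    chartInverseMetric g φ y (chartMetric g φ y v) = v := by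
  obtain ⟨e, he⟩ := exists_continuousLinearEquiv_eq_chartMetric g hφ hy
  rw [chartInverseMetric, ← he, ContinuousLinearMap.inverse_equiv]
  exact e.symm_apply_apply v

theorem exists_chartMetric_eq (hφ : φ ∈ IsManifold.maximalAtlas (𝓡 n) ∞ Q)
    {y : EuclideanSpace ℝ (Fin n)} (hy : y ∈ φ.target)
    (ξ : EuclideanSpace ℝ (Fin n) →L[ℝ] ℝ) : ∃ v, chartMetric g φ y v = ξ := by
  obtain ⟨e, he⟩ := exists_continuousLinearEquiv_eq_chartMetric g hφ hy
  exact ⟨e.symm ξ, by rw [← he]; exact e.apply_symm_apply ξ⟩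

theorem chartInverseMetric_symm (hφ : φ ∈ IsManifold.maximalAtlas (𝓡 n) ∞ Q)
    {y : EuclideanSpace ℝ (Fin n)} (hy : y ∈ φ.target)
    (ξ η : EuclideanSpace ℝ (Fin n) →L[ℝ] ℝ) :
    ξ (chartInverseMetric g φ y η) = η (chartInverseMetric g φ y ξ) := by
  obtain ⟨v, rfl⟩ := exists_chartMetric_eq g hφ hy ξ
  obtain ⟨w, rfl⟩ := exists_chartMetric_eq g hφ hy η
  rw [chartInverseMetric_chartMetric g hφ hy, chartInverseMetric_chartMetric g hφ hy,
    chartMetric_symm]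

theorem chartInverseMetric_pos (hφ : φ ∈ IsManifold.maximalAtlas (𝓡 n) ∞ Q)
    {y : EuclideanSpace ℝ (Fin n)} (hy : y ∈ φ.target)
    {ξ : EuclideanSpace ℝ (Fin n) →L[ℝ] ℝ} (hξ : ξ ≠ 0) :
    0 < ξ (chartInverseMetric g φ y ξ) := by
  obtain ⟨v, rfl⟩ := exists_chartMetric_eq g hφ hy ξ
  rw [chartInverseMetric_chartMetric g hφ hy]
  exact chartMetric_pos g hφ hy fun h ↦ hξ (by rw [h, map_zero])

theorem chartInverseMetric_contDiffOn (hφ : φ ∈ IsManifold.maximalAtlas (𝓡 n) ∞ Q) :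
    ContDiffOn ℝ ∞ (chartInverseMetric g φ) φ.target := by
  intro y hy
  obtain ⟨e, he⟩ := exists_continuousLinearEquiv_eq_chartMetric g hφ hy
  have h1 : ContDiffAt ℝ ∞ ContinuousLinearMap.inverse (chartMetric g φ y) := by
    rw [← he]
    exact contDiffAt_map_inverse e
  exact h1.comp_contDiffWithinAt y (chartMetric_contDiffOn g hφ y hy)

end InverseMetric

/-! ### Generic absence of motion in regular level sets. -/

section LevelMotions

variable {n : ℕ} {Q : Type*} [TopologicalSpace Q] [ChartedSpace (EuclideanSpace ℝ (Fin n)) Q]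
  [IsManifold (𝓡 n) ∞ Q]
  (g : Bundle.ContMDiffRiemannianMetric (𝓡 n) ∞ (EuclideanSpace ℝ (Fin n))
    (fun q : Q ↦ TangentSpace (𝓡 n) q))
  {φ : OpenPartialHomeomorph Q (EuclideanSpace ℝ (Fin n))}

theorem IsEulerLagrangeSolution.eventually_contDiffAt {L : TangentBundle (𝓡 n) Q → ℝ} {γ : ℝ → Q}
    {J : Set ℝ} (h : IsEulerLagrangeSolution L γ J) (hJ : IsOpen J) {t : ℝ} (ht : t ∈ J)
    (hφ : φ ∈ IsManifold.maximalAtlas (𝓡 n) ∞ Q) (htφ : γ t ∈ φ.source) :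
    ∀ᶠ s in 𝓝 t, s ∈ J ∧ γ s ∈ φ.source ∧ ContDiffAt ℝ 2 (fun r ↦ φ (γ r)) s := by
  have hat : ∀ s ∈ J, ContMDiffAt 𝓘(ℝ, ℝ) (𝓡 n) 2 γ s := fun s hs ↦
    h.contMDiffOn.contMDiffAt (hJ.mem_nhds hs)
  filter_upwards [hJ.mem_nhds ht,
    (hat t ht).continuousAt.preimage_mem_nhds (φ.open_source.mem_nhds htφ)] with s hs hsφ
  refine ⟨hs, hsφ, ?_⟩
  rw [← contMDiffAt_iff_contDiffAt]
  exact ((contMDiffAt_of_mem_maximalAtlas hφ hsφ).of_le ENat.LEInfty.out).comp s (hat s hs)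

/-- For potentials in an open dense set, the trajectories on which `G` is constant have no
velocity in a given compact set. -/
theorem exists_isOpen_dense_forall_velocity_notMem [T2Space Q]
    (hφ : φ ∈ IsManifold.maximalAtlas (𝓡 n) ∞ Q) {G : EuclideanSpace ℝ (Fin n) → ℝ}
    (hG : ContDiffOn ℝ ∞ G φ.target)
    {C : Set (EuclideanSpace ℝ (Fin n) × EuclideanSpace ℝ (Fin n))} (hC : IsCompact C)
    (hCφ : ∀ x ∈ C, x.1 ∈ φ.target) (hCG : ∀ x ∈ C, fderiv ℝ G x.1 ≠ 0)
    (hCv : ∀ x ∈ C, x.2 ≠ 0) :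
    ∃ O : Set C^∞⟮𝓡 n, Q; 𝓘(ℝ, ℝ), ℝ⟯, IsOpen O ∧ Dense O ∧ ∀ V ∈ O,
      ∀ (J : Set ℝ) (γ : ℝ → Q) (t r : ℝ), IsOpen J → t ∈ J → γ t ∈ φ.source →
        IsEulerLagrangeSolution (mechanicalLagrangian g V) γ J →
        (∀ᶠ s in 𝓝 t, G (φ (γ s)) = r) → (φ (γ t), deriv (fun s ↦ φ (γ s)) t) ∉ C := by
  set K := Prod.fst '' C with hKdef
  have hK : IsCompact K := hC.image continuous_fst
  have hKφ : K ⊆ φ.target := by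
    rintro _ ⟨x, hx, rfl⟩
    exact hCφ x hx
  obtain ⟨χ, hχ, hχc, hχφ, hχK⟩ := exists_contDiff_cutOff hK φ.open_target hKφ
  have hnear : ∀ {H : Type} [NormedAddCommGroup H] [NormedSpace ℝ H]
      (f : EuclideanSpace ℝ (Fin n) → H), ∀ y ∈ K, (fun y ↦ χ y • f y) =ᶠ[𝓝 y] f := by
    intro H _ _ f y hy
    filter_upwards [hχK.filter_mono (nhds_le_nhdsSet hy)] with z hz
    rw [hz, one_smul]
  set B : EuclideanSpace ℝ (Fin n) → _ := fun y ↦ χ y • chartMetric g φ y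
  set A : EuclideanSpace ℝ (Fin n) → _ := fun y ↦ χ y • chartInverseMetric g φ y
  set G' : EuclideanSpace ℝ (Fin n) → ℝ := fun y ↦ χ y • G y
  have hB : ContDiff ℝ ∞ B := contDiff_smul_of_tsupport_subset φ.open_target hχ hχφ
    (chartMetric_contDiffOn g hφ)
  have hA : ContDiff ℝ ∞ A := contDiff_smul_of_tsupport_subset φ.open_target hχ hχφ
    (chartInverseMetric_contDiffOn g hφ)
  have hG' : ContDiff ℝ ∞ G' := contDiff_smul_of_tsupport_subset φ.open_target hχ hχφ hG
  have hΓ : ContDiff ℝ ∞ (geodesicAccel B A) := geodesicAccel_contDiff hB hA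
  let W : C^∞⟮𝓡 n, Q; 𝓘(ℝ, ℝ), ℝ⟯ → EuclideanSpace ℝ (Fin n) → ℝ :=
    fun V y ↦ χ y * V (φ.symm y)
  have hW : ∀ V, ContDiff ℝ ∞ (W V) := fun V ↦ contDiff_smul_of_tsupport_subset φ.open_target
    hχ hχφ (contDiffOn_comp_chart_symm hφ V)
  have hχ0 : ∀ y ∉ φ.target, χ y = 0 := fun y hy ↦
    by_contra fun h ↦ hy (hχφ (subset_tsupport _ h))
  have hχ1 : ∀ x ∈ C, χ x.1 = 1 := fun x hx ↦
    hχK.self_of_nhdsSet _ (Set.mem_image_of_mem _ hx)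
  refine ⟨{V | ∀ x ∈ C, ∃ j ≤ 2 * n + 1, derivAlong (geodesicAccel B A) A G' (W V) j x ≠ 0},
    isOpen_forall_exists_derivAlong_ne_zero hΓ hA hG' hW hC
      (continuousDerivs_cutOff_comp_chart_symm hφ hχ hχφ hK hKφ hχK) _, ?_, ?_⟩
  · intro V
    have hsupp : ∀ c : Fin (2 * n + 1) → Option (Fin n),
        tsupport (fun y ↦ χ y * coordMonomial c y) ⊆ tsupport χ := fun c ↦
      tsupport_mul_subset_left
    choose P hPφ hP0 using fun c : Fin (2 * n + 1) → Option (Fin n) ↦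
      exists_contMDiffMap_comp_chart_symm_eq hφ (hχ.mul (coordMonomial_contDiff c)) hχc hχφ
        (hsupp c)
    have hcont := continuous_add_sum_smul_strongTopology V P
      (hχc.isCompact.image_of_continuousOn (φ.symm.continuousOn.mono hχφ)) hP0
    rw [mem_closure_iff_nhds]
    intro N hN
    have hN' : (fun s : (Fin (2 * n + 1) → Option (Fin n)) → ℝ ↦ V + ∑ c, s c • P c) ⁻¹' N ∈
        𝓝 0 := hcont.continuousAt.preimage_mem_nhds (by simpa using hN)
    have hsymm : ∀ y, ∀ ξ η : EuclideanSpace ℝ (Fin n) →L[ℝ] ℝ, ξ (A y η) = η (A y ξ) := by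
      intro y ξ η
      by_cases hy : y ∈ φ.target
      · simp [A, chartInverseMetric_symm g hφ hy ξ η]
      · simp [A, hχ0 y hy]
    have hpos : ∀ x ∈ C, fderiv ℝ G' x.1 (A x.1 (fderiv ℝ G' x.1)) ≠ 0 := by
      intro x hx
      have hxK : x.1 ∈ K := Set.mem_image_of_mem _ hx
      rw [(hnear G x.1 hxK).fderiv_eq]
      simp only [A, hχ1 x hx, one_smul]
      exact (chartInverseMetric_pos g hφ (hKφ hxK) (hCG x hx)).ne'
    -- One factor `χ` makes the monomials extend to `Q`; the other comes from the cut-off in `W`.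
    obtain ⟨s, hs, hne⟩ := exists_param_derivAlong_ne_zero (θ := fun y ↦ χ y * χ y) hΓ hA hG'
      (hW V) (hχ.mul hχ) hsymm hC (fun x hx ↦ by simp [hχ1 x hx]) hCv hpos hN'
    refine ⟨_, hs, fun x hx ↦ ?_⟩
    have hWs : W (V + ∑ c, s c • P c) =
        fun y ↦ W V y + ∑ c, s c * (χ y * χ y * coordMonomial c y) := by
      funext y
      simp only [W, add_sum_smul_apply, mul_add, Finset.mul_sum]
      congr 1
      refine Finset.sum_congr rfl fun c _ ↦ ?_
      by_cases hy : y ∈ φ.target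
      · rw [hPφ c y hy]; ring
      · simp [hχ0 y hy]
    rw [hWs]
    exact hne x hx
  · intro V hV J γ t r hJ htJ htφ hγ hGγ hmem
    set c : ℝ → EuclideanSpace ℝ (Fin n) := fun s ↦ φ (γ s) with hc
    have htK : c t ∈ K := ⟨_, hmem, rfl⟩
    have hreg := hγ.eventually_contDiffAt hJ htJ hφ htφ
    have hcont : ContinuousAt c t := hreg.self_of_nhds.2.2.continuousAt
    have hχt : ∀ᶠ s in 𝓝 t, ∀ᶠ y in 𝓝 (c s), χ y = 1 :=
      hcont.eventually (hχK.filter_mono (nhds_le_nhdsSet htK)).eventually_nhds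
    have hev := fun j ↦ eventually_derivAlong_eq_zero (t := t) (c := c) (r := r) hΓ hA hG' (hW V)
      (hreg.mono fun s hs ↦ (hs.2.2.differentiableAt (by norm_num)).hasDerivAt) ?_ ?_ j
    · obtain ⟨j, -, hj⟩ := hV _ hmem
      exact hj (hev j).self_of_nhds
    · filter_upwards [hreg, hχt] with s hs hχs
      have hsφ : c s ∈ φ.target := φ.map_source hs.2.1
      have hχ1 : χ (c s) = 1 := hχs.self_of_nhds
      refine hasDerivAt_deriv_of_eulerLagrange (B₀ := chartMetric g φ)
        (U₀ := fun y ↦ V (φ.symm y)) hB (hW V) hs.2.2 ?_ ?_ ?_ ?_ ?_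
      · filter_upwards [hχs] with y hy
        simp only [B, hy, one_smul]
      · filter_upwards [hχs] with y hy
        simp only [W, hy, one_mul]
      · exact Filter.Eventually.of_forall fun y v w ↦ chartMetric_symm g y v w
      · intro v
        simp only [A, B, hχ1, one_smul]
        exact chartInverseMetric_chartMetric g hφ hsφ v
      · exact hγ.eulerLagrange s hs.1 φ hφ hs.2.1
    · filter_upwards [hGγ, hχt] with s hs hχs
      simp only [G', hχs.self_of_nhds, one_smul]
      exact hs

/-- For a generic potential, no trajectory on which `G` is constant moves at a point where
the derivative of `G` does not vanish. -/
theorem eventually_residual_deriv_eq_zero [T2Space Q]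
    (hφ : φ ∈ IsManifold.maximalAtlas (𝓡 n) ∞ Q) {G : EuclideanSpace ℝ (Fin n) → ℝ}
    (hG : ContDiffOn ℝ ∞ G φ.target) :
    ∀ᶠ V : C^∞⟮𝓡 n, Q; 𝓘(ℝ, ℝ), ℝ⟯ in residual _,
      ∀ (J : Set ℝ) (γ : ℝ → Q) (t r : ℝ), IsOpen J → t ∈ J → γ t ∈ φ.source →
        IsEulerLagrangeSolution (mechanicalLagrangian g V) γ J →
        (∀ᶠ s in 𝓝 t, G (φ (γ s)) = r) → fderiv ℝ G (φ (γ t)) ≠ 0 →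
        deriv (fun s ↦ φ (γ s)) t = 0 := by
  set Ω : Set (EuclideanSpace ℝ (Fin n) × EuclideanSpace ℝ (Fin n)) :=
    (φ.target ∩ {y | fderiv ℝ G y ≠ 0}) ×ˢ {v | v ≠ 0}
  have hΩ : IsOpen Ω := by
    refine IsOpen.prod ?_ isOpen_ne
    exact (hG.continuousOn_fderiv_of_isOpen φ.open_target (by simp)).isOpen_inter_preimage
      φ.open_target isOpen_ne
  have : LocallyCompactSpace Ω := hΩ.locallyCompactSpace
  -- Countably many compact sets exhaust the admissible pairs, so countably many open dense
  -- conditions suffice.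
  obtain ⟨C, hC, hCΩ⟩ := isSigmaCompact_iff_sigmaCompactSpace.2
    (inferInstance : SigmaCompactSpace Ω)
  have hsub : ∀ m, C m ⊆ Ω := fun m ↦ hCΩ ▸ Set.subset_iUnion C m
  choose O hO hOd hOV using fun m ↦ exists_isOpen_dense_forall_velocity_notMem g hφ hG (hC m)
    (fun x hx ↦ (hsub m hx).1.1) (fun x hx ↦ (hsub m hx).1.2) (fun x hx ↦ (hsub m hx).2)
  have hres : ∀ᶠ V in residual C^∞⟮𝓡 n, Q; 𝓘(ℝ, ℝ), ℝ⟯, ∀ m, V ∈ O m :=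
    eventually_countable_forall.2 fun m ↦ residual_of_dense_open (hO m) (hOd m)
  filter_upwards [hres] with V hV J γ t r hJ ht htφ hγ hGγ hd
  by_contra hv
  have hmem : (φ (γ t), deriv (fun s ↦ φ (γ s)) t) ∈ Ω := ⟨⟨φ.map_source htφ, hd⟩, hv⟩
  rw [← hCΩ] at hmem
  obtain ⟨m, hm⟩ := Set.mem_iUnion.1 hmem
  exact hOV m V (hV m) J γ t r hJ ht htφ hγ hGγ hm

end LevelMotions

/-! ### Generic nondegeneracy of critical points. -/

section Morse

variable {n : ℕ}

/-- The partial derivatives of `W`, as a vector field. -/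
noncomputable def partialDerivs (W : EuclideanSpace ℝ (Fin n) → ℝ)
    (y : EuclideanSpace ℝ (Fin n)) : EuclideanSpace ℝ (Fin n) :=
  WithLp.toLp 2 fun i ↦ fderiv ℝ W y (EuclideanSpace.single i 1)

/-- The matrix of second partial derivatives of `W`. -/
noncomputable def hessianMatrix (W : EuclideanSpace ℝ (Fin n) → ℝ)
    (y : EuclideanSpace ℝ (Fin n)) : Matrix (Fin n) (Fin n) ℝ :=
  Matrix.of fun i j ↦ fderiv ℝ (fun z ↦ fderiv ℝ W z (EuclideanSpace.single i 1)) y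
    (EuclideanSpace.single j 1)

theorem partialDerivs_eq_zero_iff {W : EuclideanSpace ℝ (Fin n) → ℝ}
    {y : EuclideanSpace ℝ (Fin n)} : partialDerivs W y = 0 ↔ fderiv ℝ W y = 0 := by
  refine ⟨fun h ↦ ?_, fun h ↦ by ext i; simp [partialDerivs, h]⟩
  have h1 : ∀ i, fderiv ℝ W y (EuclideanSpace.single i 1) = 0 := fun i ↦
    congrArg (fun v : EuclideanSpace ℝ (Fin n) ↦ v i) h
  ext v
  rw [← (EuclideanSpace.basisFun (Fin n) ℝ).sum_repr v, map_sum]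
  simp [h1]

theorem partialDerivs_contDiff {W : EuclideanSpace ℝ (Fin n) → ℝ} (hW : ContDiff ℝ ∞ W) :
    ContDiff ℝ ∞ (partialDerivs W) :=
  contDiff_euclidean.2 fun _ ↦ (contDiff_fderiv_infty hW).clm_apply contDiff_const

theorem det_fderiv_partialDerivs {W : EuclideanSpace ℝ (Fin n) → ℝ} (hW : ContDiff ℝ ∞ W)
    (y : EuclideanSpace ℝ (Fin n)) :
    (fderiv ℝ (partialDerivs W) y).det = (hessianMatrix W y).det := by
  rw [ContinuousLinearMap.det,
    ← LinearMap.det_toMatrix (EuclideanSpace.basisFun (Fin n) ℝ).toBasis]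
  congr 1
  ext i j
  have h := (differentiable_of_contDiff_infty (partialDerivs_contDiff hW) y).hasFDerivAt
  have h1 := ((EuclideanSpace.proj (𝕜 := ℝ) i).hasFDerivAt.comp y h).fderiv
  have h2 := congrArg (fun L : EuclideanSpace ℝ (Fin n) →L[ℝ] ℝ ↦
    L (EuclideanSpace.single j 1)) h1
  rw [LinearMap.toMatrix_apply]
  simp only [OrthonormalBasis.coe_toBasis, EuclideanSpace.basisFun_apply,
    OrthonormalBasis.coe_toBasis_repr_apply, EuclideanSpace.basisFun_repr]
  exact h2.symm

/-- The gradient has an invertible derivative at `y`, so near `y` it takes the value `0` at most at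
`y` itself. -/
theorem eventually_fderiv_ne_zero_of_hessianMatrix {W : EuclideanSpace ℝ (Fin n) → ℝ}
    (hW : ContDiff ℝ ∞ W) {y : EuclideanSpace ℝ (Fin n)} (hdet : (hessianMatrix W y).det ≠ 0) :
    ∀ᶠ z in 𝓝[≠] y, fderiv ℝ W z ≠ 0 := by
  have h := (differentiable_of_contDiff_infty (partialDerivs_contDiff hW) y).hasFDerivAt
  rw [← det_fderiv_partialDerivs hW] at hdet
  have hanti := ((fderiv ℝ (partialDerivs W) y).toContinuousLinearEquivOfDetNeZero
    hdet).antilipschitz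
  filter_upwards [h.eventually_ne (c := 0) ⟨_, hanti⟩] with z hz h0
  exact hz (partialDerivs_eq_zero_iff.2 h0)

/-- Sard's theorem for the gradient: small linear perturbations of `W` have only nondegenerate
critical points. -/
theorem exists_mem_forall_partialDerivs_ne {W : EuclideanSpace ℝ (Fin n) → ℝ}
    (hW : ContDiff ℝ ∞ W) {O : Set (EuclideanSpace ℝ (Fin n))} (hO : O ∈ 𝓝 0) :
    ∃ τ ∈ O, ∀ y, partialDerivs W y = τ → (hessianMatrix W y).det ≠ 0 := by
  -- The gradient maps the degenerate points onto a null set. Any `τ` outside it works, since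
  -- subtracting the linear function of gradient `τ` makes critical exactly the points of gradient
  -- `τ`.
  have hnull := MeasureTheory.addHaar_image_eq_zero_of_det_fderivWithin_eq_zero
    MeasureTheory.volume (s := {y | (hessianMatrix W y).det = 0}) (f := partialDerivs W)
    (f' := fderiv ℝ (partialDerivs W))
    (fun y _ ↦ ((differentiable_of_contDiff_infty
      (partialDerivs_contDiff hW) y).hasFDerivAt).hasFDerivWithinAt)
    (fun y hy ↦ by rw [det_fderiv_partialDerivs hW]; exact hy)
  have hdense : Dense {τ | τ ∉ partialDerivs W '' {y | (hessianMatrix W y).det = 0}} :=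
    MeasureTheory.Measure.dense_of_ae (MeasureTheory.measure_eq_zero_iff_ae_notMem.1 hnull)
  obtain ⟨τ, hτO, hτ⟩ := mem_closure_iff_nhds.1 (hdense 0) O hO
  exact ⟨τ, hτO, fun y hy hdet ↦ hτ ⟨y, hdet, hy⟩⟩

variable {Q : Type*} [TopologicalSpace Q] [ChartedSpace (EuclideanSpace ℝ (Fin n)) Q]
  [IsManifold (𝓡 n) ∞ Q] {φ : OpenPartialHomeomorph Q (EuclideanSpace ℝ (Fin n))}

/-- For functions in an open dense set, the critical points in a given compact set are
nondegenerate, hence isolated. -/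
theorem exists_isOpen_dense_forall_isolated_critical [T2Space Q]
    (hφ : φ ∈ IsManifold.maximalAtlas (𝓡 n) ∞ Q) {K : Set (EuclideanSpace ℝ (Fin n))}
    (hK : IsCompact K) (hKφ : K ⊆ φ.target) :
    ∃ O : Set C^∞⟮𝓡 n, Q; 𝓘(ℝ, ℝ), ℝ⟯, IsOpen O ∧ Dense O ∧ ∀ V ∈ O, ∀ y ∈ K,
      fderiv ℝ (fun y ↦ V (φ.symm y)) y = 0 →
        ∀ᶠ z in 𝓝[≠] y, fderiv ℝ (fun y ↦ V (φ.symm y)) z ≠ 0 := by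
  obtain ⟨χ, hχ, hχc, hχφ, hχK⟩ := exists_contDiff_cutOff hK φ.open_target hKφ
  let W : C^∞⟮𝓡 n, Q; 𝓘(ℝ, ℝ), ℝ⟯ → EuclideanSpace ℝ (Fin n) → ℝ :=
    fun V y ↦ χ y * V (φ.symm y)
  have hW : ∀ V, ContDiff ℝ ∞ (W V) := fun V ↦ contDiff_smul_of_tsupport_subset φ.open_target
    hχ hχφ (contDiffOn_comp_chart_symm hφ V)
  have hχ1 : ∀ y ∈ K, ∀ᶠ z in 𝓝 y, χ z = 1 := fun y hy ↦ hχK.filter_mono (nhds_le_nhdsSet hy)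
  have hder := continuousDerivs_cutOff_comp_chart_symm hφ hχ hχφ hK hKφ hχK
  -- This sum of squares vanishes exactly at degenerate critical points, so the openness criterion
  -- applies with a single function.
  let f : C^∞⟮𝓡 n, Q; 𝓘(ℝ, ℝ), ℝ⟯ → EuclideanSpace ℝ (Fin n) → ℝ := fun V y ↦
    ∑ i, fderiv ℝ (W V) y (EuclideanSpace.single i 1) ^ 2 + (hessianMatrix (W V) y).det ^ 2
  have hf : ContinuousOn (fun p : C^∞⟮𝓡 n, Q; 𝓘(ℝ, ℝ), ℝ⟯ × EuclideanSpace ℝ (Fin n) ↦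
      f p.1 p.2) (Set.univ ×ˢ K) := by
    refine ContinuousOn.add (continuousOn_finsetSum _ fun i _ ↦
      (((hder 1).2 (EuclideanSpace.single i 1)).continuousOn).pow 2) (ContinuousOn.pow ?_ 2)
    have hdet : Continuous fun M : Matrix (Fin n) (Fin n) ℝ ↦ M.det := continuous_id.matrix_det
    refine hdet.comp_continuousOn (continuousOn_pi.2 fun i ↦ continuousOn_pi.2 fun j ↦ ?_)
    exact (((hder 2).2 (EuclideanSpace.single i 1)).2 (EuclideanSpace.single j 1)).continuousOn
  have hf0 : ∀ V y, f V y ≠ 0 ↔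
      (partialDerivs (W V) y = 0 → (hessianMatrix (W V) y).det ≠ 0) := by
    intro V y
    rw [← not_iff_not, not_not, Classical.not_imp, not_not, add_eq_zero_iff_of_nonneg
      (Finset.sum_nonneg fun i _ ↦ sq_nonneg _) (sq_nonneg _), sq_eq_zero_iff,
      Finset.sum_eq_zero_iff_of_nonneg fun i _ ↦ sq_nonneg _]
    refine and_congr_left fun _ ↦ ⟨fun h ↦ ?_, fun h i _ ↦ ?_⟩
    · ext i
      exact sq_eq_zero_iff.1 (h i (Finset.mem_univ i))
    · rw [partialDerivs_eq_zero_iff.1 h]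
      simp
  refine ⟨{V | ∀ y ∈ K, ∃ j ≤ 0, f V y ≠ 0},
    isOpen_forall_exists_ne_zero (f := fun _ ↦ f) hK fun _ ↦ hf, ?_, ?_⟩
  · intro V
    have hsm : ∀ i : Fin n, ContDiff ℝ ∞ fun y : EuclideanSpace ℝ (Fin n) ↦ χ y * y i :=
      fun i ↦ hχ.mul (contDiff_euclidean.1 contDiff_id i)
    choose P hPφ hP0 using fun i : Fin n ↦
      exists_contMDiffMap_comp_chart_symm_eq hφ (hsm i) hχc hχφ tsupport_mul_subset_left
    have hcont : Continuous fun τ : EuclideanSpace ℝ (Fin n) ↦ V + ∑ i, (-τ i) • P i :=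
      (continuous_add_sum_smul_strongTopology V P
        (hχc.isCompact.image_of_continuousOn (φ.symm.continuousOn.mono hχφ)) hP0).comp
        (f := fun (τ : EuclideanSpace ℝ (Fin n)) i ↦ -τ i) (by fun_prop)
    rw [mem_closure_iff_nhds]
    intro N hN
    obtain ⟨τ, hτ, hne⟩ := exists_mem_forall_partialDerivs_ne (hW V)
      (hcont.continuousAt.preimage_mem_nhds (x := 0) (by simpa using hN))
    refine ⟨_, hτ, fun y hy ↦ ⟨0, le_rfl, (hf0 _ _).2 fun h0 ↦ ?_⟩⟩
    -- Near `K` the perturbation is linear: it shifts the gradient by `-τ` and leaves the Hessian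
    -- alone.
    have hnear : W (V + ∑ i, (-τ i) • P i) =ᶠ[𝓝 y] fun z ↦ W V z + ∑ i, (-τ i) * z i := by
      filter_upwards [hχ1 y hy, φ.open_target.mem_nhds (hKφ hy)] with z hz hzφ
      simp only [W, hz, one_mul, add_sum_smul_apply, hPφ _ z hzφ]
    have hgrad : ∀ᶠ z in 𝓝 y, ∀ i,
        fderiv ℝ (W (V + ∑ i, (-τ i) • P i)) z (EuclideanSpace.single i 1) =
        fderiv ℝ (W V) z (EuclideanSpace.single i 1) - τ i := by
      filter_upwards [hnear.eventually_nhds] with z hz i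
      have h1 : HasFDerivAt (fun z : EuclideanSpace ℝ (Fin n) ↦ ∑ i, (-τ i) * z i)
          (∑ i, (-τ i) • EuclideanSpace.proj (𝕜 := ℝ) i) z :=
        HasFDerivAt.fun_sum fun i _ ↦
          (EuclideanSpace.proj (𝕜 := ℝ) i).hasFDerivAt.const_mul (-τ i)
      have h2 := (differentiable_of_contDiff_infty (hW V) z).hasFDerivAt.add h1
      rw [Filter.EventuallyEq.fderiv_eq hz]
      refine (congrArg (fun L : EuclideanSpace ℝ (Fin n) →L[ℝ] ℝ ↦
        L (EuclideanSpace.single i 1)) h2.fderiv).trans ?_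
      simp [sub_eq_add_neg]
    have hhess : hessianMatrix (W (V + ∑ i, (-τ i) • P i)) y = hessianMatrix (W V) y := by
      ext i j
      have h1 : (fun z ↦ fderiv ℝ (W (V + ∑ i, (-τ i) • P i)) z (EuclideanSpace.single i 1))
          =ᶠ[𝓝 y] fun z ↦ fderiv ℝ (W V) z (EuclideanSpace.single i 1) - τ i :=
        hgrad.mono fun z hz ↦ hz i
      simp only [hessianMatrix, Matrix.of_apply]
      rw [h1.fderiv_eq, fderiv_sub_const]
    rw [hhess]
    refine hne y ?_
    ext i
    have h1 := congrArg (fun v : EuclideanSpace ℝ (Fin n) ↦ v i) h0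
    simp only [partialDerivs, hgrad.self_of_nhds, PiLp.zero_apply, sub_eq_zero] at h1 ⊢
    exact h1
  · intro V hV y hy h0
    obtain ⟨-, -, hne⟩ := hV y hy
    have heq : W V =ᶠ[𝓝 y] fun y ↦ V (φ.symm y) := by
      filter_upwards [hχ1 y hy] with z hz
      simp only [W, hz, one_mul]
    have hdet := (hf0 V y).1 hne (partialDerivs_eq_zero_iff.2 (heq.fderiv_eq.trans h0))
    filter_upwards [eventually_fderiv_ne_zero_of_hessianMatrix (hW V) hdet,
      heq.eventually_nhds.filter_mono nhdsWithin_le_nhds] with z hz hz'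
    rwa [← Filter.EventuallyEq.fderiv_eq hz']

theorem eventually_residual_isolated_critical [T2Space Q]
    (hφ : φ ∈ IsManifold.maximalAtlas (𝓡 n) ∞ Q) :
    ∀ᶠ V : C^∞⟮𝓡 n, Q; 𝓘(ℝ, ℝ), ℝ⟯ in residual _, ∀ y ∈ φ.target,
      fderiv ℝ (fun y ↦ V (φ.symm y)) y = 0 →
        ∀ᶠ z in 𝓝[≠] y, fderiv ℝ (fun y ↦ V (φ.symm y)) z ≠ 0 := by
  have : LocallyCompactSpace φ.target := φ.open_target.locallyCompactSpace
  obtain ⟨K, hK, hKφ⟩ := isSigmaCompact_iff_sigmaCompactSpace.2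
    (inferInstance : SigmaCompactSpace φ.target)
  choose O hO hOd hOV using fun m ↦ exists_isOpen_dense_forall_isolated_critical hφ (hK m)
    (hKφ ▸ Set.subset_iUnion K m)
  have hres : ∀ᶠ V in residual C^∞⟮𝓡 n, Q; 𝓘(ℝ, ℝ), ℝ⟯, ∀ m, V ∈ O m :=
    eventually_countable_forall.2 fun m ↦ residual_of_dense_open (hO m) (hOd m)
  filter_upwards [hres] with V hV y hy
  rw [← hKφ] at hy
  obtain ⟨m, hm⟩ := Set.mem_iUnion.1 hy
  exact hOV m V (hV m) y hm

end Morse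

/-! ### Equilibria, and solutions confined to a level set. -/

section Equilibria

variable {n : ℕ} {Q : Type*} [TopologicalSpace Q] [ChartedSpace (EuclideanSpace ℝ (Fin n)) Q]
  [IsManifold (𝓡 n) ∞ Q]
  {φ : OpenPartialHomeomorph Q (EuclideanSpace ℝ (Fin n))}

theorem fderiv_comp_chart_symm_eq_zero_of_mem_equilibria
    (g : Bundle.ContMDiffRiemannianMetric (𝓡 n) ∞ (EuclideanSpace ℝ (Fin n))
      (fun q : Q ↦ TangentSpace (𝓡 n) q)) {V : Q → ℝ} {q : Q}
    (hq : q ∈ equilibria (mechanicalLagrangian g V))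
    (hφ : φ ∈ IsManifold.maximalAtlas (𝓡 n) ∞ Q) (hqφ : q ∈ φ.source) :
    fderiv ℝ (fun y ↦ V (φ.symm y)) (φ q) = 0 := by
  have h := hq.eulerLagrange 0 trivial φ hφ hqφ
  simp only [deriv_const] at h
  have h0 := h.unique (hasDerivAt_const (0 : ℝ) _)
  have hfun : (fun y ↦ localLagrangian (mechanicalLagrangian g V) φ y 0) =
      fun y ↦ -V (φ.symm y) := by
    funext y
    rw [localLagrangian_mechanicalLagrangian]
    simp
  rw [hfun, fderiv_fun_neg] at h0
  exact neg_eq_zero.1 h0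

/-- For a curve at rest the momentum is constant and the equation no longer involves time, so its
validity at one time gives it at all times. -/
theorem IsEulerLagrangeSolution.mem_equilibria {L : TangentBundle (𝓡 n) Q → ℝ} {γ : ℝ → Q}
    {J : Set ℝ} {t : ℝ} {q : Q} (h : IsEulerLagrangeSolution L γ J) (hJ : IsOpen J) (ht : t ∈ J)
    (hγ : ∀ s ∈ J, γ s = q) : q ∈ equilibria L := by
  refine ⟨contMDiffOn_const, fun s _ φ hφ hqφ ↦ ?_⟩
  have hev : ∀ᶠ s in 𝓝 t, γ s = q := Filter.eventually_of_mem (hJ.mem_nhds ht) hγ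
  have hd : ∀ᶠ s in 𝓝 t, deriv (fun r ↦ φ (γ r)) s = 0 := by
    filter_upwards [hev.eventually_nhds] with s hs
    have : (fun r ↦ φ (γ r)) =ᶠ[𝓝 s] fun _ ↦ φ q := hs.mono fun r hr ↦ by simp [hr]
    rw [this.deriv_eq, deriv_const]
  have hEL := h.eulerLagrange t ht φ hφ (by rwa [hγ t ht])
  rw [hd.self_of_nhds, hγ t ht] at hEL
  have hconst := hEL.congr_of_eventuallyEq (f₁ := fun _ ↦ fderiv ℝ
      (fun v ↦ localLagrangian L φ (φ q) v) 0) (by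
    filter_upwards [hev, hd] with s hs hs'
    simp [hs, hs'])
  simp only [deriv_const]
  rw [hconst.unique (hasDerivAt_const t _)]
  exact hasDerivAt_const s _

theorem IsEulerLagrangeSolution.eventually_eq {L : TangentBundle (𝓡 n) Q → ℝ} {γ : ℝ → Q}
    {J : Set ℝ} {t : ℝ} (h : IsEulerLagrangeSolution L γ J) (hJ : IsOpen J) (ht : t ∈ J)
    (hφ : φ ∈ IsManifold.maximalAtlas (𝓡 n) ∞ Q) (htφ : γ t ∈ φ.source)
    (hd : ∀ᶠ s in 𝓝 t, deriv (fun r ↦ φ (γ r)) s = 0) : ∀ᶠ s in 𝓝 t, γ s = γ t := by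
  obtain ⟨ε, hε, hball⟩ := Metric.eventually_nhds_iff_ball.1
    ((h.eventually_contDiffAt hJ ht hφ htφ).and hd)
  filter_upwards [Metric.ball_mem_nhds t hε] with s hs
  refine φ.injOn (hball s hs).1.2.1 htφ ?_
  exact Metric.isOpen_ball.is_const_of_deriv_eq_zero
    (f := fun r ↦ φ (γ r)) (convex_ball t ε).isPreconnected
    (fun r hr ↦ ((hball r hr).1.2.2.differentiableAt (by simp)).differentiableWithinAt)
    (fun r hr ↦ (hball r hr).2) hs (Metric.mem_ball_self hε)

theorem mfderiv_eq_zero_of_fderiv_comp_chart_symm (F : C^∞⟮𝓡 n, Q; 𝓘(ℝ, ℝ), ℝ⟯)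
    (hφ : φ ∈ IsManifold.maximalAtlas (𝓡 n) ∞ Q) {x : Q} (hx : x ∈ φ.source)
    (h : fderiv ℝ (fun y ↦ F (φ.symm y)) (φ x) = 0) : mfderiv (𝓡 n) 𝓘(ℝ, ℝ) F x = 0 := by
  have heq : (F : Q → ℝ) =ᶠ[𝓝 x] (fun y ↦ F (φ.symm y)) ∘ φ := by
    filter_upwards [φ.open_source.mem_nhds hx] with z hz
    simp [φ.left_inv hz]
  have hF : DifferentiableAt ℝ (fun y ↦ F (φ.symm y)) (φ x) :=
    ((contDiffOn_comp_chart_symm hφ F).contDiffAt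
      (φ.open_target.mem_nhds (φ.map_source hx))).differentiableAt (by simp)
  have hφx : MDifferentiableAt (𝓡 n) (𝓡 n) φ x :=
    (contMDiffAt_of_mem_maximalAtlas hφ hx).mdifferentiableAt (by simp)
  rw [heq.mfderiv_eq, mfderiv_comp x hF.mdifferentiableAt hφx, mfderiv_eq_fderiv, h]
  exact ContinuousLinearMap.zero_comp _

theorem Set.OrdConnected.eq_of_eventually_eq {X : Type*} {J : Set ℝ} {γ : ℝ → X}
    (hJ : J.OrdConnected) (h : ∀ t ∈ J, ∀ᶠ s in 𝓝 t, γ s = γ t) {s t : ℝ} (hs : s ∈ J)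
    (ht : t ∈ J) : γ s = γ t := by
  have : PreconnectedSpace J := isPreconnected_iff_preconnectedSpace.1 hJ.isPreconnected
  have hloc : IsLocallyConstant (fun r : J ↦ γ r) :=
    (IsLocallyConstant.iff_eventually_eq _).2 fun r ↦
      continuous_subtype_val.continuousAt.eventually (h r r.2)
  exact hloc.apply_eq_of_preconnectedSpace ⟨s, hs⟩ ⟨t, ht⟩

/-- A solution of the Euler–Lagrange equations of `L` that stays in a level set of `G` near a time
at which, in the chart `φ`, the function `G` is not critical has zero velocity at that time. -/
def NoLevelMotion (L : TangentBundle (𝓡 n) Q → ℝ)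
    (φ : OpenPartialHomeomorph Q (EuclideanSpace ℝ (Fin n)))
    (G : EuclideanSpace ℝ (Fin n) → ℝ) : Prop :=
  ∀ (J : Set ℝ) (γ : ℝ → Q) (t r : ℝ), IsOpen J → t ∈ J → γ t ∈ φ.source →
    IsEulerLagrangeSolution L γ J → (∀ᶠ s in 𝓝 t, G (φ (γ s)) = r) →
    fderiv ℝ G (φ (γ t)) ≠ 0 → deriv (fun s ↦ φ (γ s)) t = 0

/-- A nonzero velocity at `t₁` persists near `t₁`, so by the condition on `F` all nearby positions
are critical and lie in `Z`. There the form `l`, which has no critical points, is constantly `0`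
along the curve, and the condition on `l` makes the curve constant near `t₁`, a contradiction. -/
theorem IsEulerLagrangeSolution.eventually_eq_of_noLevelMotion {L : TangentBundle (𝓡 n) Q → ℝ}
    {F : C^∞⟮𝓡 n, Q; 𝓘(ℝ, ℝ), ℝ⟯} {Z : Set Q}
    (hF : ∀ q : Q, mfderiv (𝓡 n) 𝓘(ℝ, ℝ) F q = 0 → q ∈ Z)
    (hQ : ∀ q : Q, ∃ φ ∈ IsManifold.maximalAtlas (𝓡 n) ∞ Q, q ∈ φ.source ∧
      NoLevelMotion L φ (fun y ↦ F (φ.symm y)))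
    (hZ : ∀ q ∈ Z, ∃ φ ∈ IsManifold.maximalAtlas (𝓡 n) ∞ Q, q ∈ φ.source ∧
      ∃ l : EuclideanSpace ℝ (Fin n) →L[ℝ] ℝ, l ≠ 0 ∧ (∀ x ∈ φ.source, x ∈ Z → l (φ x) = 0) ∧
        NoLevelMotion L φ l)
    {γ : ℝ → Q} {J : Set ℝ} {c t : ℝ} (h : IsEulerLagrangeSolution L γ J) (hJ : IsOpen J)
    (hc : ∀ s ∈ J, F (γ s) = c) (ht : t ∈ J) : ∀ᶠ s in 𝓝 t, γ s = γ t := by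
  obtain ⟨φ, hφ, htφ, hlevel⟩ := hQ (γ t)
  refine h.eventually_eq hJ ht hφ htφ ?_
  filter_upwards [(h.eventually_contDiffAt hJ ht hφ htφ).eventually_nhds] with t₁ hreg
  by_contra hne
  obtain ⟨ht₁, ht₁φ, hsm⟩ := hreg.self_of_nhds
  have hnear : ∀ᶠ s in 𝓝 t₁, deriv (fun r ↦ φ (γ r)) s ≠ 0 :=
    hsm.hasDerivAt_deriv.continuousAt.eventually_ne hne
  have hmem : ∀ᶠ s in 𝓝 t₁, γ s ∈ Z := by
    filter_upwards [hreg.eventually_nhds, hnear] with s hs hs'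
    obtain ⟨hsJ, hsφ, -⟩ := hs.self_of_nhds
    refine hF _ (mfderiv_eq_zero_of_fderiv_comp_chart_symm F hφ hsφ ?_)
    by_contra hcrit
    refine hs' (hlevel J γ s c hJ hsJ hsφ h ?_ hcrit)
    filter_upwards [hs] with r hr
    rw [φ.left_inv hr.2.1, hc r hr.1]
  obtain ⟨ψ, hψ, ht₁ψ, l, hl, hlZ, hlevel'⟩ := hZ (γ t₁) hmem.self_of_nhds
  have hconst : ∀ᶠ s in 𝓝 t₁, γ s = γ t₁ := by
    refine h.eventually_eq hJ ht₁ hψ ht₁ψ ?_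
    filter_upwards [(h.eventually_contDiffAt hJ ht₁ hψ ht₁ψ).eventually_nhds,
      hmem.eventually_nhds] with s hs hsZ
    obtain ⟨hsJ, hsψ, -⟩ := hs.self_of_nhds
    refine hlevel' J γ s 0 hJ hsJ hsψ h ?_ (by rwa [l.fderiv])
    filter_upwards [hs, hsZ] with r hr hrZ
    exact hlZ _ hr.2.1 hrZ
  refine hne ?_
  have : (fun r ↦ φ (γ r)) =ᶠ[𝓝 t₁] fun _ ↦ φ (γ t₁) := hconst.mono fun r hr ↦ by simp [hr]
  rw [this.deriv_eq, deriv_const]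

omit [IsManifold (𝓡 n) ∞ Q] in
/-- Around each point of a hypersurface there is a chart in which it lies in the kernel of a
nonzero linear form. -/
theorem IsSubmanifoldOfCodim.exists_chart_linear_form {Z : Set Q}
    (hZ : IsSubmanifoldOfCodim (n := n) 1 Z) (q : Z) :
    ∃ (φ : OpenPartialHomeomorph Q (EuclideanSpace ℝ (Fin n)))
      (l : EuclideanSpace ℝ (Fin n) →L[ℝ] ℝ), φ ∈ IsManifold.maximalAtlas (𝓡 n) ∞ Q ∧
      (q : Q) ∈ φ.source ∧ l ≠ 0 ∧ ∀ x ∈ φ.source, x ∈ Z → l (φ x) = 0 := by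
  obtain ⟨φ, hφ, hq, W, hW, hWZ⟩ := hZ q q.2
  have hlt : W < ⊤ := by
    refine lt_top_iff_ne_top.2 fun htop ↦ ?_
    rw [htop, finrank_top, finrank_euclideanSpace_fin] at hW
    omega
  obtain ⟨l, hl, hlW⟩ := W.exists_le_ker_of_lt_top hlt
  refine ⟨φ, LinearMap.toContinuousLinearMap l, hφ, hq, ?_, fun x hx hxZ ↦
    hlW ((hWZ x hx).1 hxZ)⟩
  exact fun h0 ↦ hl (LinearMap.toContinuousLinearMap.map_eq_zero_iff.1 h0)

theorem exists_isOpen_equilibria_inter_eq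
    (g : Bundle.ContMDiffRiemannianMetric (𝓡 n) ∞ (EuclideanSpace ℝ (Fin n))
      (fun q : Q ↦ TangentSpace (𝓡 n) q)) {V : Q → ℝ}
    (hφ : φ ∈ IsManifold.maximalAtlas (𝓡 n) ∞ Q)
    (hV : ∀ y ∈ φ.target, fderiv ℝ (fun y ↦ V (φ.symm y)) y = 0 →
      ∀ᶠ z in 𝓝[≠] y, fderiv ℝ (fun y ↦ V (φ.symm y)) z ≠ 0)
    {q : Q} (hq : q ∈ equilibria (mechanicalLagrangian g V)) (hqφ : q ∈ φ.source) :
    ∃ U : Set Q, IsOpen U ∧ equilibria (mechanicalLagrangian g V) ∩ U = {q} := by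
  have hev := hV _ (φ.map_source hqφ)
    (fderiv_comp_chart_symm_eq_zero_of_mem_equilibria g hq hφ hqφ)
  obtain ⟨O, hO, hOo, hqO⟩ := eventually_nhds_iff.1 (eventually_nhdsWithin_iff.1 hev)
  refine ⟨φ.source ∩ φ ⁻¹' O, φ.isOpen_inter_preimage hOo, ?_⟩
  refine Set.Subset.antisymm ?_ (Set.singleton_subset_iff.2 ⟨hq, hqφ, hqO⟩)
  rintro x ⟨hx, hxφ, hxO⟩
  by_contra hne
  exact hO _ hxO (fun h ↦ hne (φ.injOn hxφ hqφ h))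
    (fderiv_comp_chart_symm_eq_zero_of_mem_equilibria g hx hφ hxφ)

end Equilibria

/-! ### Globalization by countably many charts. -/

theorem mainTheorem1 {n : ℕ} {Q : Type*} [TopologicalSpace Q] [T2Space Q]
    [SecondCountableTopology Q] [ChartedSpace (EuclideanSpace ℝ (Fin n)) Q]
    [IsManifold (𝓡 n) ∞ Q]
    (g : Bundle.ContMDiffRiemannianMetric (𝓡 n) ∞ (EuclideanSpace ℝ (Fin n))
      (fun q : Q ↦ TangentSpace (𝓡 n) q))
    (F : C^∞⟮𝓡 n, Q; 𝓘(ℝ, ℝ), ℝ⟯)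
    (hF : ∃ Z : Set Q, IsSubmanifoldOfCodim (n := n) 1 Z ∧
      ∀ q : Q, mfderiv (𝓡 n) 𝓘(ℝ, ℝ) F q = 0 → q ∈ Z) :
    ∃ 𝒞 ∈ residual C^∞⟮𝓡 n, Q; 𝓘(ℝ, ℝ), ℝ⟯, ∀ V ∈ 𝒞,
      (∀ (J : Set ℝ) (γ : ℝ → Q), IsOpen J → J.OrdConnected → J.Nonempty →
        IsEulerLagrangeSolution (mechanicalLagrangian g V) γ J →
        (∃ c : ℝ, ∀ t ∈ J, F (γ t) = c) →
        ∃ q ∈ equilibria (mechanicalLagrangian g V), ∀ t ∈ J, γ t = q) ∧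
      (∀ q ∈ equilibria (mechanicalLagrangian g V),
        ∃ U : Set Q, IsOpen U ∧ equilibria (mechanicalLagrangian g V) ∩ U = {q}) := by
  obtain ⟨Z, hZ, hFZ⟩ := hF
  have hchart : ∀ q : Q, chartAt (EuclideanSpace ℝ (Fin n)) q ∈
      IsManifold.maximalAtlas (𝓡 n) ∞ Q := fun q ↦ IsManifold.chart_mem_maximalAtlas q
  choose ψ l hψ hzψ hl hlZ using hZ.exists_chart_linear_form
  obtain ⟨S, hS, hSQ⟩ := TopologicalSpace.isOpen_iUnion_countable
    (fun q : Q ↦ (chartAt (EuclideanSpace ℝ (Fin n)) q).source) fun q ↦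
      (chartAt (EuclideanSpace ℝ (Fin n)) q).open_source
  -- Second countability gives a countable subcover of the union of these charts; `Z` need not be
  -- closed.
  obtain ⟨T, hT, hTZ⟩ := TopologicalSpace.isOpen_iUnion_countable
    (fun z : Z ↦ (ψ z).source) fun z ↦ (ψ z).open_source
  have hScover : ∀ q : Q, ∃ p ∈ S, q ∈ (chartAt (EuclideanSpace ℝ (Fin n)) p).source := by
    intro q
    have : q ∈ ⋃ p, (chartAt (EuclideanSpace ℝ (Fin n)) p).source :=
      Set.mem_iUnion.2 ⟨q, mem_chart_source _ q⟩
    rw [← hSQ] at this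
    simpa using this
  have hTcover : ∀ z ∈ Z, ∃ p ∈ T, z ∈ (ψ p).source := by
    intro z hz
    have : z ∈ ⋃ p, (ψ p).source := Set.mem_iUnion.2 ⟨⟨z, hz⟩, hzψ _⟩
    rw [← hTZ] at this
    simpa using this
  have hlevel : ∀ᶠ V : C^∞⟮𝓡 n, Q; 𝓘(ℝ, ℝ), ℝ⟯ in residual _, ∀ p ∈ S,
      NoLevelMotion (mechanicalLagrangian g V) (chartAt (EuclideanSpace ℝ (Fin n)) p)
        (fun y ↦ F ((chartAt (EuclideanSpace ℝ (Fin n)) p).symm y)) :=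
    (eventually_countable_ball hS).2 fun p _ ↦ eventually_residual_deriv_eq_zero g (hchart p)
      (contDiffOn_comp_chart_symm (hchart p) F)
  have hlevelZ : ∀ᶠ V : C^∞⟮𝓡 n, Q; 𝓘(ℝ, ℝ), ℝ⟯ in residual _, ∀ p ∈ T,
      NoLevelMotion (mechanicalLagrangian g V) (ψ p) (l p) :=
    (eventually_countable_ball hT).2 fun p _ ↦ eventually_residual_deriv_eq_zero g (hψ p)
      (l p).contDiff.contDiffOn
  have hmorse : ∀ᶠ V : C^∞⟮𝓡 n, Q; 𝓘(ℝ, ℝ), ℝ⟯ in residual _, ∀ p ∈ S,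
      ∀ y ∈ (chartAt (EuclideanSpace ℝ (Fin n)) p).target,
      fderiv ℝ (fun y ↦ V ((chartAt (EuclideanSpace ℝ (Fin n)) p).symm y)) y = 0 →
      ∀ᶠ z in 𝓝[≠] y,
        fderiv ℝ (fun y ↦ V ((chartAt (EuclideanSpace ℝ (Fin n)) p).symm y)) z ≠ 0 :=
    (eventually_countable_ball hS).2 fun p _ ↦ eventually_residual_isolated_critical (hchart p)
  refine ⟨_, hlevel.and (hlevelZ.and hmorse), fun V hV ↦ ?_⟩
  obtain ⟨hV₁, hV₂, hV₃⟩ := hV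
  refine ⟨fun J γ hJ hJc ⟨t, ht⟩ hγ ⟨c, hc⟩ ↦ ?_, fun q hq ↦ ?_⟩
  · have hconst : ∀ s ∈ J, γ s = γ t := by
      refine fun s hs ↦ hJc.eq_of_eventually_eq (fun r hr ↦ ?_) hs ht
      refine hγ.eventually_eq_of_noLevelMotion hFZ (fun q ↦ ?_) (fun z hz ↦ ?_) hJ hc hr
      · obtain ⟨p, hp, hqp⟩ := hScover q
        exact ⟨_, hchart p, hqp, hV₁ p hp⟩
      · obtain ⟨p, hp, hzp⟩ := hTcover z hz
        exact ⟨_, hψ p, hzp, l p, hl p, hlZ p, hV₂ p hp⟩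
    exact ⟨γ t, hγ.mem_equilibria hJ ht hconst, hconst⟩
  · obtain ⟨p, hp, hqp⟩ := hScover q
    exact exists_isOpen_equilibria_inter_eq g (hchart p) (hV₃ p hp) hq hqp
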